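/- For a Laurent series $x$ and $y=q^{r}$ with $r\ge 1$, write $(x;y)_\infty=\prod_{i\ge 0}(1-xy^{i})$ and $(x_1,\dots,x_m;y)_\infty=\prod_{j=1}^{m}(x_j;y)_\infty$ (formal Laurent series in $q$), and let $\mathrm{Sg}(x)=1$ if $x\ge 0$ and $\mathrm{Sg}(x)=-1$ if $x<0$. **Theorem.** Let $a,b\in\mathbb{Z}$ and let $R,S$ be positive integers with $1\le S<R/2$. Then for every integer $k\ge 1$ the coefficient of $q^{k}$ in the formal Laurent series $$\frac{\mathrm{Sg}(a+b)}{(q^{-S},q^{R+S},q^{R};q^{R})_\infty\,(q^{R-2S},q^{R+2S};q^{2R})_\infty}\sum_{n=a}^{b}q^{n(3n+1)R/2}\left(q^{3nS}-q^{-(3n+1)S}\right)$$ is non-negative, where the sum is empty (equal to $0$) if $a>b$. -/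

import Mathlib

noncomputable section

/-- The formal variable `q` of the field `ℚ((q))` of formal Laurent series. -/
def qVar : LaurentSeries ℚ := HahnSeries.single (1 : ℤ) (1 : ℚ)

/-- The infinite `q`-shifted factorial `(x; y)_∞ = ∏_{i ≥ 0} (1 - x yⁱ)` for formal Laurent series
`x, y`. The infinite product is taken in the `q`-adic topology of `ℚ((q))`; it converges whenever
`y` has positive `q`-adic order, see `multipliable_qPochInf`. -/
def qPochInf (x y : LaurentSeries ℚ) : LaurentSeries ℚ := ∏' i : ℕ, (1 - x * y ^ i)

/-- The quintuple product
`(q^{-S}, q^{R+S}, q^R; q^R)_∞ (q^{R-2S}, q^{R+2S}; q^{2R})_∞`. -/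
def quintupleProduct (R S : ℤ) : LaurentSeries ℚ :=
  (qPochInf (qVar ^ (-S)) (qVar ^ R) * qPochInf (qVar ^ (R + S)) (qVar ^ R) *
      qPochInf (qVar ^ R) (qVar ^ R)) *
    (qPochInf (qVar ^ (R - 2 * S)) (qVar ^ (2 * R)) *
      qPochInf (qVar ^ (R + 2 * S)) (qVar ^ (2 * R)))

/-- The partial sum `∑_{n=a}^{b} q^{n(3n+1)R/2} (q^{3nS} - q^{-(3n+1)S})`, empty if `a > b`.
The integer `n(3n+1)` is even, so that the division of integers is exact. -/
def quintuplePartialSum (R S a b : ℤ) : LaurentSeries ℚ :=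
  ∑ n ∈ Finset.Icc a b,
    qVar ^ (n * (3 * n + 1) * R / 2) * (qVar ^ (3 * n * S) - qVar ^ (-(3 * n + 1) * S))

/-- `Sg(x) = 1` if `x ≥ 0` and `Sg(x) = -1` if `x < 0`. -/
def Sg (x : ℤ) : ℤ := if 0 ≤ x then 1 else -1

/-! Sanity facts: the infinite products converge, and the quintuple product is not zero. -/

lemma qVar_zpow (n : ℤ) : qVar ^ n = HahnSeries.single n (1 : ℚ) := by
  have h : ∀ m : ℕ, qVar ^ m = HahnSeries.single (m : ℤ) (1 : ℚ) := by
    intro m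
    simp [qVar, HahnSeries.single_pow]
  obtain m | m := n
  · simpa using h m
  · rw [zpow_negSucc, h, HahnSeries.inv_single, inv_one, Int.negSucc_eq]
    norm_num

lemma valuation_qVar_zpow (n : ℤ) :
    Valued.v (qVar ^ n) = WithZero.exp (-n) := by
  rw [qVar_zpow, LaurentSeries.valuation_single_zpow]

open WithZero in
lemma valuation_prod_sub_one_lt {x y : LaurentSeries ℚ} {c : ℤᵐ⁰} (hc : 0 < c) (hc1 : c ≤ 1)
    (t : Finset ℕ) (h : ∀ i ∈ t, Valued.v (x * y ^ i) < c) :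
    Valued.v (∏ i ∈ t, (1 - x * y ^ i) - 1) < c := by
  classical
  induction t using Finset.induction_on with
  | empty => simpa using hc
  | insert j s hj ih =>
    have ih' := ih fun i hi => h i (Finset.mem_insert_of_mem hi)
    have hP : Valued.v (∏ i ∈ s, (1 - x * y ^ i)) ≤ 1 := by
      have := Valued.v.map_add (∏ i ∈ s, (1 - x * y ^ i) - 1) 1
      rw [sub_add_cancel, map_one] at this
      exact this.trans (max_le (ih'.le.trans hc1) le_rfl)
    rw [Finset.prod_insert hj, show ∀ u P : LaurentSeries ℚ,
      (1 - u) * P - 1 = (P - 1) - u * P from fun u P => by ring]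
    refine (Valued.v.map_sub _ _).trans_lt (max_lt ih' ?_)
    rw [map_mul]
    exact (mul_le_of_le_one_right' hP).trans_lt (h j (Finset.mem_insert_self _ _))

open WithZero in
lemma exists_tail_lt {x y : LaurentSeries ℚ} (hy : Valued.v y < 1) {c : ℤᵐ⁰} (hc : 0 < c) :
    ∃ N : ℕ, ∀ i, N ≤ i → Valued.v (x * y ^ i) < c := by
  rcases eq_or_ne x 0 with rfl | hx
  · exact ⟨0, fun i _ => by simpa using hc⟩
  · have hvx : 0 < Valued.v x := zero_lt_iff.mpr ((Valuation.ne_zero_iff _).mpr hx)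
    have hcx : 0 < c / Valued.v x := div_pos hc hvx
    obtain ⟨N, hN⟩ := exists_pow_lt₀ hy (Units.mk0 _ hcx.ne')
    refine ⟨N, fun i hi => ?_⟩
    rw [map_mul, map_pow, mul_comm]
    exact (lt_div_iff₀ hvx).mp ((pow_le_pow_right_of_le_one' hy.le hi).trans_lt hN)

open WithZero in
lemma multipliable_qPochInf {x y : LaurentSeries ℚ} (hy : Valued.v y < 1) :
    Multipliable fun i : ℕ => 1 - x * y ^ i := by
  classical
  rw [multipliable_iff_cauchySeq_finset, CauchySeq, Valued.cauchy_iff]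
  refine ⟨inferInstance, fun γ => ?_⟩
  set c : ℤᵐ⁰ := MonoidWithZeroHom.ValueGroup₀.embedding γ.1 with hcdef
  have hc : 0 < c := zero_lt_iff.mpr (by simp [hcdef])
  obtain ⟨N₀, hN₀⟩ := exists_tail_lt (x := x) hy (c := 1) zero_lt_one
  set A : ℤᵐ⁰ := Valued.v (∏ i ∈ Finset.range N₀, (1 - x * y ^ i)) with hA
  have hA' : 0 < max A 1 := lt_max_of_lt_right zero_lt_one
  obtain ⟨N, hN⟩ := exists_tail_lt (x := x) hy (c := min (c / max A 1) 1)
    (lt_min (div_pos hc hA') zero_lt_one)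
  set s := Finset.range (max N₀ N) with hs
  have hle : Valued.v (∏ i ∈ s, (1 - x * y ^ i)) ≤ A := by
    have hsub : Finset.range N₀ ⊆ s := Finset.range_mono (le_max_left _ _)
    have h1 := valuation_prod_sub_one_lt (x := x) (y := y) zero_lt_one le_rfl
      (s \ Finset.range N₀) (fun i hi => hN₀ i (by simpa using (Finset.mem_sdiff.mp hi).2))
    have h2 := Valued.v.map_add (∏ i ∈ s \ Finset.range N₀, (1 - x * y ^ i) - 1) 1
    rw [sub_add_cancel, map_one] at h2
    rw [← Finset.prod_sdiff hsub, map_mul]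
    exact mul_le_of_le_one_left' (h2.trans (max_le h1.le le_rfl))
  have key : ∀ t, s ⊆ t →
      Valued.v (∏ i ∈ t, (1 - x * y ^ i) - ∏ i ∈ s, (1 - x * y ^ i)) < c := by
    intro t ht
    have h1 := valuation_prod_sub_one_lt (x := x) (y := y)
      (lt_min (div_pos hc hA') zero_lt_one) (min_le_right _ _) (t \ s)
      (fun i hi => hN i (by
        have := (Finset.mem_sdiff.mp hi).2
        simp only [hs, Finset.mem_range, not_lt] at this
        exact (le_max_right _ _).trans this))
    rw [← Finset.prod_sdiff ht, show ∀ u w : LaurentSeries ℚ, u * w - w = (u - 1) * w from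
      fun u w => by ring, map_mul]
    calc _ ≤ Valued.v (∏ i ∈ t \ s, (1 - x * y ^ i) - 1) * max A 1 := by
            gcongr
            exact hle.trans (le_max_left _ _)
      _ < c := (lt_div_iff₀ hA').mp (h1.trans_le (min_le_left _ _))
  refine ⟨_, Filter.image_mem_map (Filter.mem_atTop s), ?_⟩
  rintro _ ⟨t, ht, rfl⟩ _ ⟨u, hu, rfl⟩
  rw [Valuation.restrict_lt_iff_lt_embedding]
  have h := Valued.v.map_sub (∏ i ∈ u, (1 - x * y ^ i) - ∏ i ∈ s, (1 - x * y ^ i))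
    (∏ i ∈ t, (1 - x * y ^ i) - ∏ i ∈ s, (1 - x * y ^ i))
  rw [sub_sub_sub_cancel_right] at h
  exact h.trans_lt (max_lt (key u hu) (key t ht))

open WithZero in
lemma qPochInf_ne_zero {x y : LaurentSeries ℚ} (hy : Valued.v y < 1)
    (h : ∀ i : ℕ, x * y ^ i ≠ 1) : qPochInf x y ≠ 0 := by
  classical
  intro h0
  have hp := (multipliable_qPochInf (x := x) hy).hasProd
  rw [show ∏' i : ℕ, (1 - x * y ^ i) = 0 from h0] at hp
  obtain ⟨N, hN⟩ := exists_tail_lt (x := x) hy (c := 1) zero_lt_one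
  set s := Finset.range N with hs
  have hs0 : Valued.v (∏ i ∈ s, (1 - x * y ^ i)) ≠ 0 := by
    rw [Valuation.ne_zero_iff, Finset.prod_ne_zero_iff]
    exact fun i _ => sub_ne_zero.mpr (h i).symm
  have hr : Valued.v.restrict (∏ i ∈ s, (1 - x * y ^ i)) ≠ 0 := by
    rwa [Valuation.ne_zero_iff] at hs0 ⊢
  have hnear : {z : LaurentSeries ℚ |
      Valued.v.restrict z < Valued.v.restrict (∏ i ∈ s, (1 - x * y ^ i))} ∈ nhds 0 :=
    Valued.mem_nhds_zero.mpr ⟨Units.mk0 _ hr, by simp⟩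
  obtain ⟨t, ht⟩ := Filter.mem_atTop_sets.mp (hp hnear)
  have h2 : Valued.v (∏ i ∈ t ∪ s, (1 - x * y ^ i)) < _ := Valued.v.restrict_lt_iff.mp (ht (t ∪ s) Finset.subset_union_left)
  have h1 := valuation_prod_sub_one_lt (x := x) (y := y) zero_lt_one le_rfl ((t ∪ s) \ s)
    (fun i hi => hN i (by simpa [hs] using (Finset.mem_sdiff.mp hi).2))
  have h3 : Valued.v (∏ i ∈ (t ∪ s) \ s, (1 - x * y ^ i)) = 1 := by
    rw [← map_one (Valued.v (R := LaurentSeries ℚ))]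
    exact Valuation.map_eq_of_sub_lt Valued.v (by rwa [map_one])
  rw [← Finset.prod_sdiff (Finset.subset_union_right : s ⊆ t ∪ s), map_mul, h3, one_mul] at h2
  exact lt_irrefl _ h2

lemma quintupleProduct_ne_zero (R S : ℤ) (hS : 1 ≤ S) (hSR : 2 * S < R) :
    quintupleProduct R S ≠ 0 := by
  have key : ∀ s r : ℤ, 0 < r → (∀ i : ℕ, s + r * i ≠ 0) →
      qPochInf (qVar ^ s) (qVar ^ r) ≠ 0 := by
    intro s r hr h
    refine qPochInf_ne_zero ?_ fun i hi => h i ?_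
    · rw [valuation_qVar_zpow, ← WithZero.exp_zero, WithZero.exp_lt_exp]
      omega
    · have hv := congrArg (Valued.v (R := LaurentSeries ℚ)) hi
      have hq : qVar ≠ 0 := by simp [qVar]
      rw [← zpow_natCast, ← zpow_mul, ← zpow_add₀ hq, valuation_qVar_zpow, map_one,
        ← WithZero.exp_zero, WithZero.exp_inj] at hv
      omega
  have pos : ∀ s r : ℤ, 0 < s → 0 < r → qPochInf (qVar ^ s) (qVar ^ r) ≠ 0 :=
    fun s r hs hr => key s r hr fun i => by positivity
  refine mul_ne_zero (mul_ne_zero (mul_ne_zero (key _ _ (by omega) fun i => ?_)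
    (pos _ _ (by omega) (by omega))) (pos _ _ (by omega) (by omega)))
    (mul_ne_zero (pos _ _ (by omega) (by omega)) (pos _ _ (by omega) (by omega)))
  rcases i with _ | i
  · simp; omega
  · push_cast
    nlinarith [mul_nonneg (by omega : (0 : ℤ) ≤ R) (Int.natCast_nonneg i)]

end

/-!
Write `q` for `q^R`, `z` for `q^S` and `u = 1/z`, and let `T n` be the `n`-th summand divided by the
quintuple product. Since the product contains the factor `1 - u`, the series `T n` is, up to sign, a
power of `q` times `(u^l - z^(l+1)) / (1 - z) = u^l + u^(l-1) + ⋯ + z^l` over a product of factors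
`1 - q^e` with `e > 0`: it has non-negative coefficients for `n ≥ 0` and non-positive ones for
`n < 0`. Hence only two extremal ranges matter: `∑_{|n| ≤ m} T n - 1` and
`1 - ∑_{n=-m-1}^{m} T n` must have non-negative coefficients (`symmetric_sum_sub_one_nonneg`,
`one_sub_cut_sum_nonneg`).

Both follow from a finite form of the quintuple product identity,
`∑_{j=-n}^{n} z^(3j) q^(j(3j-1)/2) (1 - z q^j) (q)_{2n} (-zq)_n (-q/z)_n /
((q)_{n+j} (q)_{n-j} (z²q)_{n+j} (q/z²)_{n-j}) = 1 - z`,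
in which the monomial `z^(-3i)` of the summand `j = -i` and the monomial `z^(3i+1)` of the summand
`j = i` tend, as `n → ∞`, to the two monomials of `T i`, up to the factor `1 - z`. Truncated to
`i ∈ [-m, m]` or `i ∈ [-m-1, m]`, the sum equals `1 - z` for `n = 0`, and when `n` grows by one its
change telescopes in `i` to a boundary term. These boundary terms, given by `increment` and
`incrementCut`, are explicit: they are antisymmetrisations under `z ↔ u` of a combination of powers of `u`, whose coefficients are
Gaussian binomials, over products of factors `1 - z² q^i`, `1 - u² q^i`. Expanding the latter as
geometric series shows that they have non-negative coefficients (`increment_nonneg`,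
`incrementCut_nonneg`). Summing over `n` and letting `n → ∞` gives the two extremal cases.

The sums are handled one half at a time: `halfSum q z u n m` collects the monomials `u^l` of the
truncated sum, the monomials `z^(l+1)` form `z * halfSum q u z n m`, and the truncated sum
is the difference of the two, divided by `1 - z`.
-/

open Filter Topology

/-! ### The finite form of the quintuple product identity and its truncations -/

/-- The finite product `∏_{i=1}^{n} (1 - x qⁱ)`, that is `(xq; q)_n`. -/
def shiftedFactorial {F : Type*} [Field F] (q x : F) (n : ℕ) : F :=
  ∏ i ∈ Finset.range n, (1 - x * q ^ (i + 1))

section Algebra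

variable {F : Type*} [Field F]

lemma shiftedFactorial_zero (q x : F) : shiftedFactorial q x 0 = 1 := by
  simp [shiftedFactorial]

lemma shiftedFactorial_succ (q x : F) (n : ℕ) :
    shiftedFactorial q x (n + 1) = shiftedFactorial q x n * (1 - x * q ^ (n + 1)) := by
  simp [shiftedFactorial, Finset.prod_range_succ]

/-- The second pentagonal number `m(3m+1)/2`, the exponent of `q` in the summand `n = m`; the
summand `n = -(m+1)` has exponent `m(3m+1)/2 + 2m + 1`. -/
def secondPentagonal (m : ℕ) : ℕ := m * (3 * m + 1) / 2

lemma two_mul_secondPentagonal (m : ℕ) : 2 * secondPentagonal m = m * (3 * m + 1) := by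
  refine Nat.mul_div_cancel' ?_
  rcases Nat.even_or_odd' m with ⟨c, rfl | rfl⟩
  · exact ⟨c * (3 * (2 * c) + 1), by ring⟩
  · exact ⟨(2 * c + 1) * (3 * c + 2), by ring⟩

lemma secondPentagonal_succ (m : ℕ) :
    secondPentagonal (m + 1) = secondPentagonal m + (3 * m + 2) := by
  have h1 := two_mul_secondPentagonal m
  have h2 := two_mul_secondPentagonal (m + 1)
  have : (m + 1) * (3 * (m + 1) + 1) = m * (3 * m + 1) + 2 * (3 * m + 2) := by ring
  omega

/-- The factor that accompanies the monomial `u^(3m)`, and also `u^(3m-1)`, in the finite quintuple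
product identity of level `n`. Here `u` stands for `1/z`. It is set to `0` for `m > n`, in agreement
with `1/(q)_{n-m} = 0`, so that the sum of level `n` terminates by itself. -/
def weight (q z u : F) (n m : ℕ) : F :=
  if m ≤ n then
    shiftedFactorial q 1 (2 * n) * (shiftedFactorial q (-z) n * shiftedFactorial q (-u) n) /
      (shiftedFactorial q 1 (n + m) * shiftedFactorial q 1 (n - m) *
        (shiftedFactorial q (z ^ 2) (n - m) * shiftedFactorial q (u ^ 2) (n + m)))
  else 0

/-- The monomials `u^l` in the finite quintuple sum of level `n`, truncated to the summands with
index in `[-m, m]`. The monomials `z^(l+1)` of that sum form `z * halfSum q u z n m`. -/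
def halfSum (q z u : F) (n : ℕ) : ℕ → F
  | 0 => weight q z u n 0
  | m + 1 => halfSum q z u n m
      - q ^ (secondPentagonal m + (2 * m + 1)) * u ^ (3 * m + 2) * weight q z u n (m + 1)
      + q ^ secondPentagonal (m + 1) * u ^ (3 * m + 3) * weight q z u n (m + 1)

/-- The boundary term that arises in passing from level `m + k` to level `m + k + 1` in the sum
truncated to `[-m, m]`. As in `halfSum`, only the part in `u` is kept. -/
def boundary (q z u : F) (m k : ℕ) : F :=
  q ^ (secondPentagonal m + (2 * m + k + 1)) *
    (shiftedFactorial q (-z) (m + k) * shiftedFactorial q (-u) (m + k)) *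
    (shiftedFactorial q 1 (2 * m + 2 * k) /
      (shiftedFactorial q 1 (2 * m + k + 1) * shiftedFactorial q 1 k)) *
    ((1 - q ^ (2 * m + k + 1)) * u ^ (3 * m + 2) +
      q ^ (m + k + 1) * (1 - q ^ (2 * m + 2 * k + 1)) * u ^ (3 * m + 1) +
      (1 - q ^ k) * u ^ (3 * m)) /
    (shiftedFactorial q (z ^ 2) k * shiftedFactorial q (u ^ 2) (2 * m + k + 1))

/-- The negative of the boundary term that arises in passing from level `m + k` to level `m + k + 1`
in the sum truncated to `[-m-1, m]`. -/
def boundaryCut (q z u : F) (m k : ℕ) : F :=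
  q ^ (secondPentagonal m + (3 * m + 2)) *
    (shiftedFactorial q (-z) (m + k) * shiftedFactorial q (-u) (m + k)) *
    (shiftedFactorial q 1 (2 * m + 2 * k + 1) /
      (shiftedFactorial q 1 (2 * m + k + 2) * shiftedFactorial q 1 k)) *
    (q ^ k * (1 - q ^ k * q ^ (2 * (2 * m + k + 2))) * u ^ (3 * m + 3) +
      q ^ (m + k + 1) * (1 - q ^ (2 * k) * q ^ (2 * m + k + 2)) * u ^ (3 * m + 2) +
      q ^ (m + k + 1) * (1 - q ^ (2 * m + k + 2)) * u ^ (3 * m + 4) +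
      q ^ k * (1 - q ^ k) * u ^ (3 * m + 1)) /
    (shiftedFactorial q (z ^ 2) k * shiftedFactorial q (u ^ 2) (2 * m + k + 2))

variable {q z u : F}

/-- The rational function identity behind `boundaryCut_add_boundary_left`: `Q`, `K`, `G`, `v` stand
for the powers of `q` and `u` with variable exponents, the other letters for shifted factorials. -/
lemma cut_identity_left (q z u Q K a b c Z U X Y G v : F) (hzu : z * u = 1)
    (hb : b ≠ 0) (hc : c ≠ 0) (hZ : Z ≠ 0) (hU : U ≠ 0)
    (h1 : 1 - Q ^ 2 * K * q ^ 3 ≠ 0) (h2 : 1 - q * K ≠ 0) (h3 : 1 - z ^ 2 * (q * K) ≠ 0)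
    (h4 : 1 - u ^ 2 * (Q ^ 2 * K * q ^ 3) ≠ 0) :
    G * (Q ^ 3 * q ^ 2) * (X * Y) *
      (a * (1 - Q ^ 2 * K ^ 2 * q ^ 3) / (b * (1 - Q ^ 2 * K * q ^ 3) * (c * (1 - q * K)))) *
      (q * K * (1 - q * K * (Q ^ 2 * K * q ^ 3) ^ 2) * (v * u ^ 3) +
       Q * K * q ^ 2 * (1 - (q * K) ^ 2 * (Q ^ 2 * K * q ^ 3)) * (v * u ^ 2) +
       Q * K * q ^ 2 * (1 - Q ^ 2 * K * q ^ 3) * (v * u ^ 4) +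
       q * K * (1 - q * K) * (v * u)) /
      (Z * (1 - z ^ 2 * (q * K)) * (U * (1 - u ^ 2 * (Q ^ 2 * K * q ^ 3)))) +
    G * (Q ^ 2 * K * q ^ 2) * (X * Y) * (a / (b * (c * (1 - q * K)))) *
      ((1 - Q ^ 2 * K * q ^ 2) * (v * u ^ 2) + Q * K * q ^ 2 * (1 - Q ^ 2 * K ^ 2 * q ^ 3) * (v * u)
        + (1 - q * K) * v) / (Z * (1 - z ^ 2 * (q * K)) * U) =
    G * (Q ^ 2 * q) * (v * u ^ 2) *
      (a * (1 - Q ^ 2 * K ^ 2 * q ^ 3) * (1 - Q ^ 2 * K ^ 2 * q ^ 4) *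
        (X * (1 + z * (Q * K * q ^ 2)) * (Y * (1 + u * (Q * K * q ^ 2)))) /
        (b * (1 - Q ^ 2 * K * q ^ 3) * (c * (1 - q * K)) *
         (Z * (1 - z ^ 2 * (q * K)) * (U * (1 - u ^ 2 * (Q ^ 2 * K * q ^ 3))))) -
       a * (X * Y) / (b * c * (Z * U))) := by
  have hz0 : z ≠ 0 := left_ne_zero_of_mul_eq_one hzu
  have hu' : u = z⁻¹ := eq_inv_of_mul_eq_one_right hzu
  -- Denominators are cleared while the factors `1 - ⋯` are still atoms; only then is `u`
  -- replaced by `z⁻¹`.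
  generalize e1 : 1 - Q ^ 2 * K * q ^ 3 = D1 at *
  generalize e2 : 1 - q * K = D2 at *
  generalize e3 : 1 - z ^ 2 * (q * K) = D3 at *
  generalize e4 : 1 - u ^ 2 * (Q ^ 2 * K * q ^ 3) = D4 at *
  field_simp
  subst e1 e2 e3 e4 hu'
  field_simp
  ring

/-- The rational function identity behind `boundaryCut_add_boundary_right`. -/
lemma cut_identity_right (q z u Q K a b c Z U X Y G v : F) (hzu : z * u = 1)
    (hb : b ≠ 0) (hc : c ≠ 0) (hZ : Z ≠ 0) (hU : U ≠ 0)
    (h1 : 1 - Q ^ 2 * K * q ^ 3 ≠ 0) (h2 : 1 - q * K ≠ 0) (h3 : 1 - z ^ 2 * (q * K) ≠ 0)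
    (h4 : 1 - u ^ 2 * (Q ^ 2 * K * q ^ 3) ≠ 0) :
    G * (Q ^ 3 * q ^ 2) * (X * Y) *
      (a * (1 - Q ^ 2 * K ^ 2 * q ^ 3) / (b * (1 - Q ^ 2 * K * q ^ 3) * (c * (1 - q * K)))) *
      (q * K * (1 - q * K * (Q ^ 2 * K * q ^ 3) ^ 2) * (v * u ^ 3) +
       Q * K * q ^ 2 * (1 - (q * K) ^ 2 * (Q ^ 2 * K * q ^ 3)) * (v * u ^ 2) +
       Q * K * q ^ 2 * (1 - Q ^ 2 * K * q ^ 3) * (v * u ^ 4) +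
       q * K * (1 - q * K) * (v * u)) /
      (Z * (1 - z ^ 2 * (q * K)) * (U * (1 - u ^ 2 * (Q ^ 2 * K * q ^ 3)))) +
    G * (Q ^ 5 * K * q ^ 5) * (X * Y) * (a / (b * (1 - Q ^ 2 * K * q ^ 3) * c)) *
      ((1 - Q ^ 2 * K * q ^ 3) * (v * u ^ 5) +
        Q * K * q ^ 2 * (1 - Q ^ 2 * K ^ 2 * q ^ 3) * (v * u ^ 4)
        + (1 - K) * (v * u ^ 3)) / (Z * (U * (1 - u ^ 2 * (Q ^ 2 * K * q ^ 3)))) =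
    G * (Q ^ 3 * q ^ 2) * (v * u ^ 3) *
      (a * (1 - Q ^ 2 * K ^ 2 * q ^ 3) * (1 - Q ^ 2 * K ^ 2 * q ^ 4) *
        (X * (1 + z * (Q * K * q ^ 2)) * (Y * (1 + u * (Q * K * q ^ 2)))) /
        (b * (1 - Q ^ 2 * K * q ^ 3) * (c * (1 - q * K)) *
         (Z * (1 - z ^ 2 * (q * K)) * (U * (1 - u ^ 2 * (Q ^ 2 * K * q ^ 3))))) -
       a * (X * Y) / (b * c * (Z * U))) := by
  have hz0 : z ≠ 0 := left_ne_zero_of_mul_eq_one hzu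
  have hu' : u = z⁻¹ := eq_inv_of_mul_eq_one_right hzu
  generalize e1 : 1 - Q ^ 2 * K * q ^ 3 = D1 at *
  generalize e2 : 1 - q * K = D2 at *
  generalize e3 : 1 - z ^ 2 * (q * K) = D3 at *
  generalize e4 : 1 - u ^ 2 * (Q ^ 2 * K * q ^ 3) = D4 at *
  field_simp
  subst e1 e2 e3 e4 hu'
  field_simp
  ring

lemma factor_ne_zero {x : F} (h : ∀ n, shiftedFactorial q x n ≠ 0) (n : ℕ) :
    1 - x * q ^ (n + 1) ≠ 0 := by
  have := h (n + 1)
  rw [shiftedFactorial_succ] at this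
  exact right_ne_zero_of_mul this

/-- The case of `boundaryCut_add_boundary_left` in which one of the two weights vanishes. -/
lemma cut_identity_left_zero (q z u Q a U X Y G v : F) (hzu : z * u = 1)
    (ha : a ≠ 0) (hU : U ≠ 0) (h1 : 1 - Q ^ 2 * q ≠ 0) (h2 : 1 - Q ^ 2 * q ^ 2 ≠ 0)
    (h4 : 1 - u ^ 2 * (Q ^ 2 * q ^ 2) ≠ 0) :
    G * (Q ^ 3 * q ^ 2) * (X * Y) *
      (a * (1 - Q ^ 2 * q) / (a * (1 - Q ^ 2 * q) * (1 - Q ^ 2 * q ^ 2))) *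
      ((1 - (Q ^ 2 * q ^ 2) ^ 2) * (v * u ^ 3) + Q * q * (1 - Q ^ 2 * q ^ 2) * (v * u ^ 2) +
       Q * q * (1 - Q ^ 2 * q ^ 2) * (v * u ^ 4)) / (U * (1 - u ^ 2 * (Q ^ 2 * q ^ 2))) +
    G * (Q ^ 2 * q) * (X * Y) * (a / (a * (1 - Q ^ 2 * q))) *
      ((1 - Q ^ 2 * q) * (v * u ^ 2) + Q * q * (1 - Q ^ 2 * q) * (v * u)) / U =
    G * (Q ^ 2 * q) * (v * u ^ 2) *
      (a * (1 - Q ^ 2 * q) * (1 - Q ^ 2 * q ^ 2) *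
        (X * (1 + z * (Q * q)) * (Y * (1 + u * (Q * q)))) /
        (a * (1 - Q ^ 2 * q) * (1 - Q ^ 2 * q ^ 2) * (U * (1 - u ^ 2 * (Q ^ 2 * q ^ 2))))) := by
  have hz0 : z ≠ 0 := left_ne_zero_of_mul_eq_one hzu
  have hu' : u = z⁻¹ := eq_inv_of_mul_eq_one_right hzu
  generalize e1 : 1 - Q ^ 2 * q = D1 at *
  generalize e2 : 1 - Q ^ 2 * q ^ 2 = D2 at *
  generalize e4 : 1 - u ^ 2 * (Q ^ 2 * q ^ 2) = D4 at *
  field_simp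
  subst e1 e2 e4 hu'
  field_simp
  ring

/-- The rational function identity behind `boundaryCut_zero`. -/
lemma cut_identity_right_zero (q z u Q a U X Y G v : F) (hzu : z * u = 1)
    (ha : a ≠ 0) (hU : U ≠ 0) (h1 : 1 - Q ^ 2 * q ≠ 0) (h2 : 1 - Q ^ 2 * q ^ 2 ≠ 0)
    (h4 : 1 - u ^ 2 * (Q ^ 2 * q ^ 2) ≠ 0) :
    G * (Q ^ 3 * q ^ 2) * (X * Y) *
      (a * (1 - Q ^ 2 * q) / (a * (1 - Q ^ 2 * q) * (1 - Q ^ 2 * q ^ 2))) *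
      ((1 - (Q ^ 2 * q ^ 2) ^ 2) * (v * u ^ 3) + Q * q * (1 - Q ^ 2 * q ^ 2) * (v * u ^ 2) +
       Q * q * (1 - Q ^ 2 * q ^ 2) * (v * u ^ 4)) / (U * (1 - u ^ 2 * (Q ^ 2 * q ^ 2))) =
    G * (Q ^ 3 * q ^ 2) * (v * u ^ 3) *
      (a * (1 - Q ^ 2 * q) * (1 - Q ^ 2 * q ^ 2) *
        (X * (1 + z * (Q * q)) * (Y * (1 + u * (Q * q)))) /
        (a * (1 - Q ^ 2 * q) * (1 - Q ^ 2 * q ^ 2) * (U * (1 - u ^ 2 * (Q ^ 2 * q ^ 2))))) := by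
  have hz0 : z ≠ 0 := left_ne_zero_of_mul_eq_one hzu
  have hu' : u = z⁻¹ := eq_inv_of_mul_eq_one_right hzu
  generalize e1 : 1 - Q ^ 2 * q = D1 at *
  generalize e2 : 1 - Q ^ 2 * q ^ 2 = D2 at *
  generalize e4 : 1 - u ^ 2 * (Q ^ 2 * q ^ 2) = D4 at *
  field_simp
  subst e1 e2 e4 hu'
  field_simp
  ring

/-- Removing the summand `-m-1` from the range `[-m-1, m]` changes the boundary term by the
increment of that summand. -/
lemma boundaryCut_add_boundary_left (hzu : z * u = 1)
    (h1 : ∀ n, shiftedFactorial q 1 n ≠ 0) (hz : ∀ n, shiftedFactorial q (z ^ 2) n ≠ 0)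
    (hu : ∀ n, shiftedFactorial q (u ^ 2) n ≠ 0) (m k : ℕ) :
    boundaryCut q z u m k + boundary q z u m k =
      q ^ (secondPentagonal m + (2 * m + 1)) * u ^ (3 * m + 2) *
        (weight q z u (m + k + 1) (m + 1) - weight q z u (m + k) (m + 1)) := by
  cases k with
  | zero =>
    have f1 := factor_ne_zero h1 (2 * m)
    have f2 := factor_ne_zero h1 (2 * m + 1)
    have f4 := factor_ne_zero hu (2 * m + 1)
    have h0 := h1 (2 * m)
    have hU := hu (2 * m + 1)
    rw [weight, weight, if_pos (by omega), if_neg (by omega), boundaryCut, boundary,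
      show m + 0 + 1 + (m + 1) = 2 * m + 1 + 1 by ring,
      show m + 0 + 1 - (m + 1) = 0 by omega,
      show 2 * (m + 0 + 1) = 2 * m + 1 + 1 by ring,
      show 2 * m + 2 * 0 + 1 = 2 * m + 1 by ring,
      show 2 * m + 2 * 0 = 2 * m by ring, show 2 * m + 0 + 1 = 2 * m + 1 by ring,
      show 2 * m + 0 + 2 = 2 * m + 1 + 1 by ring, add_zero]
    simp only [shiftedFactorial_succ _ _ (2 * m), shiftedFactorial_succ _ _ (2 * m + 1),
      shiftedFactorial_succ _ _ m, shiftedFactorial_zero, sub_zero]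
    have := cut_identity_left_zero q z u (q ^ m) (shiftedFactorial q 1 (2 * m))
      (shiftedFactorial q (u ^ 2) (2 * m + 1)) (shiftedFactorial q (-z) m)
      (shiftedFactorial q (-u) m) (q ^ secondPentagonal m) (u ^ (3 * m)) hzu h0 hU
      (by convert f1 using 1; ring) (by convert f2 using 1; ring) (by convert f4 using 1; ring)
    simp only [shiftedFactorial_succ _ _ (2 * m)] at this
    linear_combination this
  | succ k =>
    have f1 := factor_ne_zero h1 (2 * m + k + 2)
    have f2 := factor_ne_zero h1 k
    have f3 := factor_ne_zero hz k
    have f4 := factor_ne_zero hu (2 * m + k + 2)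
    have := cut_identity_left q z u (q ^ m) (q ^ k) (shiftedFactorial q 1 (2 * m + 2 * k + 2))
      (shiftedFactorial q 1 (2 * m + k + 2)) (shiftedFactorial q 1 k)
      (shiftedFactorial q (z ^ 2) k) (shiftedFactorial q (u ^ 2) (2 * m + k + 2))
      (shiftedFactorial q (-z) (m + k + 1)) (shiftedFactorial q (-u) (m + k + 1))
      (q ^ secondPentagonal m) (u ^ (3 * m)) hzu (h1 _) (h1 _) (hz _) (hu _)
      (by convert f1 using 1; ring) (by convert f2 using 1; ring) (by convert f3 using 1; ring)
      (by convert f4 using 1; ring)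
    rw [weight, weight, if_pos (by omega), if_pos (by omega), boundaryCut, boundary,
      show m + (k + 1) + 1 + (m + 1) = 2 * m + k + 2 + 1 by ring,
      show m + (k + 1) + 1 - (m + 1) = k + 1 by omega,
      show m + (k + 1) + (m + 1) = 2 * m + k + 2 by ring,
      show m + (k + 1) - (m + 1) = k by omega,
      show 2 * (m + (k + 1) + 1) = 2 * m + 2 * k + 2 + 1 + 1 by ring,
      show 2 * (m + (k + 1)) = 2 * m + 2 * k + 2 by ring,
      show 2 * m + 2 * (k + 1) + 1 = 2 * m + 2 * k + 2 + 1 by ring,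
      show 2 * m + 2 * (k + 1) = 2 * m + 2 * k + 2 by ring,
      show 2 * m + (k + 1) + 1 = 2 * m + k + 2 by ring,
      show 2 * m + (k + 1) + 2 = 2 * m + k + 2 + 1 by ring,
      show m + (k + 1) = m + k + 1 by ring]
    simp only [shiftedFactorial_succ _ _ (2 * m + k + 2), shiftedFactorial_succ _ _ (m + k + 1),
      shiftedFactorial_succ _ _ k, shiftedFactorial_succ _ _ (2 * m + 2 * k + 2),
      shiftedFactorial_succ _ _ (2 * m + 2 * k + 2 + 1)]
    linear_combination this

/-- The case of `boundaryCut_add_boundary_right` in which the level reaches `m + 1`, so that the sum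
truncated to `[-m-1, m+1]` is complete and has no boundary term. -/
lemma boundaryCut_zero (hzu : z * u = 1)
    (h1 : ∀ n, shiftedFactorial q 1 n ≠ 0)
    (hu : ∀ n, shiftedFactorial q (u ^ 2) n ≠ 0) (m : ℕ) :
    boundaryCut q z u m 0 =
      q ^ secondPentagonal (m + 1) * u ^ (3 * m + 3) *
        (weight q z u (m + 1) (m + 1) - weight q z u m (m + 1)) := by
  have f1 := factor_ne_zero h1 (2 * m)
  have f2 := factor_ne_zero h1 (2 * m + 1)
  have f4 := factor_ne_zero hu (2 * m + 1)
  have h0 := h1 (2 * m)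
  have hU := hu (2 * m + 1)
  rw [secondPentagonal_succ, weight, weight, if_pos (by omega), if_neg (by omega), boundaryCut,
    show m + 1 + (m + 1) = 2 * m + 1 + 1 by ring,
    show m + 1 - (m + 1) = 0 by omega,
    show 2 * (m + 1) = 2 * m + 1 + 1 by ring,
    show 2 * m + 2 * 0 + 1 = 2 * m + 1 by ring,
    show 2 * m + 0 + 2 = 2 * m + 1 + 1 by ring, add_zero]
  simp only [shiftedFactorial_succ _ _ (2 * m), shiftedFactorial_succ _ _ (2 * m + 1),
    shiftedFactorial_succ _ _ m, shiftedFactorial_zero, sub_zero]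
  have := cut_identity_right_zero q z u (q ^ m) (shiftedFactorial q 1 (2 * m))
    (shiftedFactorial q (u ^ 2) (2 * m + 1)) (shiftedFactorial q (-z) m)
    (shiftedFactorial q (-u) m) (q ^ secondPentagonal m) (u ^ (3 * m)) hzu h0 hU
    (by convert f1 using 1; ring) (by convert f2 using 1; ring) (by convert f4 using 1; ring)
  simp only [shiftedFactorial_succ _ _ (2 * m)] at this
  linear_combination this

/-- Adding the summand `m+1` to the range `[-m-1, m]` changes the boundary term by the increment of
that summand. -/
lemma boundaryCut_add_boundary_right (hzu : z * u = 1)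
    (h1 : ∀ n, shiftedFactorial q 1 n ≠ 0) (hz : ∀ n, shiftedFactorial q (z ^ 2) n ≠ 0)
    (hu : ∀ n, shiftedFactorial q (u ^ 2) n ≠ 0) (m k : ℕ) :
    boundaryCut q z u m (k + 1) + boundary q z u (m + 1) k =
      q ^ secondPentagonal (m + 1) * u ^ (3 * m + 3) *
        (weight q z u (m + k + 2) (m + 1) - weight q z u (m + k + 1) (m + 1)) := by
  have f1 := factor_ne_zero h1 (2 * m + k + 2)
  have f2 := factor_ne_zero h1 k
  have f3 := factor_ne_zero hz k
  have f4 := factor_ne_zero hu (2 * m + k + 2)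
  have := cut_identity_right q z u (q ^ m) (q ^ k) (shiftedFactorial q 1 (2 * m + 2 * k + 2))
    (shiftedFactorial q 1 (2 * m + k + 2)) (shiftedFactorial q 1 k)
    (shiftedFactorial q (z ^ 2) k) (shiftedFactorial q (u ^ 2) (2 * m + k + 2))
    (shiftedFactorial q (-z) (m + k + 1)) (shiftedFactorial q (-u) (m + k + 1))
    (q ^ secondPentagonal m) (u ^ (3 * m)) hzu (h1 _) (h1 _) (hz _) (hu _)
    (by convert f1 using 1; ring) (by convert f2 using 1; ring) (by convert f3 using 1; ring)
    (by convert f4 using 1; ring)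
  rw [weight, weight, if_pos (by omega), if_pos (by omega), boundaryCut, boundary,
    secondPentagonal_succ,
    show m + k + 2 + (m + 1) = 2 * m + k + 2 + 1 by ring,
    show m + k + 2 - (m + 1) = k + 1 by omega,
    show m + k + 1 + (m + 1) = 2 * m + k + 2 by ring,
    show m + k + 1 - (m + 1) = k by omega,
    show 2 * (m + k + 2) = 2 * m + 2 * k + 2 + 1 + 1 by ring,
    show 2 * (m + k + 1) = 2 * m + 2 * k + 2 by ring,
    show 2 * m + 2 * (k + 1) + 1 = 2 * m + 2 * k + 2 + 1 by ring,
    show 2 * (m + 1) + 2 * k + 1 = 2 * m + 2 * k + 2 + 1 by ring,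
    show 2 * (m + 1) + 2 * k = 2 * m + 2 * k + 2 by ring,
    show 2 * (m + 1) + k + 1 = 2 * m + k + 2 + 1 by ring,
    show 2 * m + (k + 1) + 2 = 2 * m + k + 2 + 1 by ring,
    show m + (k + 1) = m + k + 1 by ring, show m + 1 + k = m + k + 1 by ring,
    show m + k + 2 = m + k + 1 + 1 by ring]
  simp only [shiftedFactorial_succ _ _ (2 * m + k + 2), shiftedFactorial_succ _ _ (m + k + 1),
    shiftedFactorial_succ _ _ k, shiftedFactorial_succ _ _ (2 * m + 2 * k + 2),
    shiftedFactorial_succ _ _ (2 * m + 2 * k + 2 + 1)]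
  linear_combination this

/-- The rational function identity behind `boundary_antisymm`. -/
lemma antisymm_identity (q z u K a c Z U X Y : F) (hzu : z * u = 1)
    (hc : c ≠ 0) (hZ : Z ≠ 0) (hU : U ≠ 0) (h2 : 1 - q * K ≠ 0)
    (h3 : 1 - z ^ 2 * (q * K) ≠ 0) (h4 : 1 - u ^ 2 * (q * K) ≠ 0) :
    (q * K * (X * Y) * (a / (c * (1 - q * K) * c)) *
      ((1 - q * K) * u ^ 2 + q * K * (1 - q * K ^ 2) * u + (1 - K)) /
        (Z * (U * (1 - u ^ 2 * (q * K)))) -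
     z * (q * K * (X * Y) * (a / (c * (1 - q * K) * c)) *
      ((1 - q * K) * z ^ 2 + q * K * (1 - q * K ^ 2) * z + (1 - K)) /
        (U * (Z * (1 - z ^ 2 * (q * K)))))) =
    (1 - z) * (a * (1 - q * K ^ 2) * (1 - q ^ 2 * K ^ 2) *
        (X * (1 + z * (q * K)) * (Y * (1 + u * (q * K)))) /
        (c * (1 - q * K) * (c * (1 - q * K)) *
          (Z * (1 - z ^ 2 * (q * K)) * (U * (1 - u ^ 2 * (q * K))))) -
       a * (X * Y) / (c * c * (Z * U))) := by
  have hz0 : z ≠ 0 := left_ne_zero_of_mul_eq_one hzu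
  have hu' : u = z⁻¹ := eq_inv_of_mul_eq_one_right hzu
  generalize e2 : 1 - q * K = D2 at *
  generalize e3 : 1 - z ^ 2 * (q * K) = D3 at *
  generalize e4 : 1 - u ^ 2 * (q * K) = D4 at *
  field_simp
  subst e2 e3 e4 hu'
  field_simp
  ring

/-- The telescoping starts at `m = 0`; here the two halves of the sum have to be combined. -/
lemma boundary_antisymm (hzu : z * u = 1)
    (h1 : ∀ n, shiftedFactorial q 1 n ≠ 0) (hz : ∀ n, shiftedFactorial q (z ^ 2) n ≠ 0)
    (hu : ∀ n, shiftedFactorial q (u ^ 2) n ≠ 0) (k : ℕ) :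
    boundary q z u 0 k - z * boundary q u z 0 k =
      (1 - z) * (weight q z u (k + 1) 0 - weight q z u k 0) := by
  have f2 := factor_ne_zero h1 k
  have f3 := factor_ne_zero hz k
  have f4 := factor_ne_zero hu k
  have := antisymm_identity q z u (q ^ k) (shiftedFactorial q 1 (2 * k)) (shiftedFactorial q 1 k)
    (shiftedFactorial q (z ^ 2) k) (shiftedFactorial q (u ^ 2) k)
    (shiftedFactorial q (-z) k) (shiftedFactorial q (-u) k)
    hzu (h1 _) (hz _) (hu _)
    (by convert f2 using 1; ring) (by convert f3 using 1; ring)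
    (by convert f4 using 1; ring)
  rw [weight, weight, if_pos (by omega), if_pos (by omega), boundary, boundary]
  simp only [show secondPentagonal 0 = 0 from rfl, mul_zero, zero_add, add_zero, Nat.sub_zero,
    pow_zero, mul_one, show 2 * (k + 1) = 2 * k + 1 + 1 by ring, shiftedFactorial_succ _ _ k,
    shiftedFactorial_succ _ _ (2 * k), shiftedFactorial_succ _ _ (2 * k + 1)]
  linear_combination this

/-- The change of `halfSum` from level `n` to level `n + 1`, up to a contribution which the
antisymmetrisation under `z ↔ u` removes, see `halfSum_antisymm_succ`. It vanishes for `n < m`,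
where nothing is truncated. -/
def increment (q z u : F) (n m : ℕ) : F := if m ≤ n then boundary q z u m (n - m) else 0

/-- The monomials `u^l` in the finite quintuple sum of level `n`, truncated to the summands with
index in `[-m-1, m]`. -/
def halfSumCut (q z u : F) (n m : ℕ) : F :=
  halfSum q z u n m
    - q ^ (secondPentagonal m + (2 * m + 1)) * u ^ (3 * m + 2) * weight q z u n (m + 1)

/-- The negative of the change of `halfSumCut` from level `n` to level `n + 1`, up to a contribution
which the antisymmetrisation under `z ↔ u` removes. -/
def incrementCut (q z u : F) (n m : ℕ) : F := if m ≤ n then boundaryCut q z u m (n - m) else 0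

lemma incrementCut_add_left (hzu : z * u = 1)
    (h1 : ∀ n, shiftedFactorial q 1 n ≠ 0) (hz : ∀ n, shiftedFactorial q (z ^ 2) n ≠ 0)
    (hu : ∀ n, shiftedFactorial q (u ^ 2) n ≠ 0) (n m : ℕ) :
    incrementCut q z u n m + increment q z u n m =
      q ^ (secondPentagonal m + (2 * m + 1)) * u ^ (3 * m + 2) *
        (weight q z u (n + 1) (m + 1) - weight q z u n (m + 1)) := by
  by_cases h : m ≤ n
  · obtain ⟨k, rfl⟩ := Nat.exists_eq_add_of_le h
    simpa [increment, incrementCut] using boundaryCut_add_boundary_left hzu h1 hz hu m k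
  · simp [increment, incrementCut, weight, h, show ¬ m + 1 ≤ n by omega]

lemma incrementCut_add_right (hzu : z * u = 1)
    (h1 : ∀ n, shiftedFactorial q 1 n ≠ 0) (hz : ∀ n, shiftedFactorial q (z ^ 2) n ≠ 0)
    (hu : ∀ n, shiftedFactorial q (u ^ 2) n ≠ 0) (n m : ℕ) :
    incrementCut q z u n m + increment q z u n (m + 1) =
      q ^ secondPentagonal (m + 1) * u ^ (3 * m + 3) *
        (weight q z u (n + 1) (m + 1) - weight q z u n (m + 1)) := by
  by_cases h : m ≤ n
  · obtain ⟨k, rfl⟩ := Nat.exists_eq_add_of_le h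
    cases k with
    | zero => simpa [increment, incrementCut] using boundaryCut_zero hzu h1 hu m
    | succ k =>
      have := boundaryCut_add_boundary_right hzu h1 hz hu m k
      rw [increment, incrementCut, if_pos h, if_pos (by omega),
        show m + (k + 1) - m = k + 1 by omega, show m + (k + 1) - (m + 1) = k by omega]
      exact this
  · simp [increment, incrementCut, weight, h, show ¬ m + 1 ≤ n by omega]

/-- The difference between the change of `halfSum` and `increment` does not depend on `m`: this is
the telescoping. -/
lemma halfSum_sub_increment (hzu : z * u = 1)
    (h1 : ∀ n, shiftedFactorial q 1 n ≠ 0) (hz : ∀ n, shiftedFactorial q (z ^ 2) n ≠ 0)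
    (hu : ∀ n, shiftedFactorial q (u ^ 2) n ≠ 0) (n m : ℕ) :
    halfSum q z u (n + 1) m - halfSum q z u n m - increment q z u n m =
      weight q z u (n + 1) 0 - weight q z u n 0 - increment q z u n 0 := by
  induction m with
  | zero => simp [halfSum]
  | succ m ih =>
    have hl := incrementCut_add_left hzu h1 hz hu n m
    have hr := incrementCut_add_right hzu h1 hz hu n m
    simp only [halfSum]
    linear_combination ih + hl - hr

lemma weight_zero_right_swap (q z u : F) (n : ℕ) : weight q u z n 0 = weight q z u n 0 := by
  simp only [weight, Nat.zero_le, if_true, Nat.sub_zero, Nat.add_zero]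
  rw [mul_comm (shiftedFactorial q (-u) n), mul_comm (shiftedFactorial q (u ^ 2) n)]

lemma halfSum_antisymm_succ (hzu : z * u = 1)
    (h1 : ∀ n, shiftedFactorial q 1 n ≠ 0) (hz : ∀ n, shiftedFactorial q (z ^ 2) n ≠ 0)
    (hu : ∀ n, shiftedFactorial q (u ^ 2) n ≠ 0) (n m : ℕ) :
    halfSum q z u (n + 1) m - z * halfSum q u z (n + 1) m =
      (halfSum q z u n m - z * halfSum q u z n m) +
        (increment q z u n m - z * increment q u z n m) := by
  have a := halfSum_sub_increment hzu h1 hz hu n m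
  have b := halfSum_sub_increment ((mul_comm u z).trans hzu) h1 hu hz n m
  rw [weight_zero_right_swap q z u, weight_zero_right_swap q z u] at b
  have c := boundary_antisymm hzu h1 hz hu n
  simp only [increment, Nat.zero_le, if_true, Nat.sub_zero] at a b ⊢
  linear_combination a - z * b - c

lemma halfSumCut_antisymm_succ (hzu : z * u = 1)
    (h1 : ∀ n, shiftedFactorial q 1 n ≠ 0) (hz : ∀ n, shiftedFactorial q (z ^ 2) n ≠ 0)
    (hu : ∀ n, shiftedFactorial q (u ^ 2) n ≠ 0) (n m : ℕ) :
    halfSumCut q z u (n + 1) m - z * halfSumCut q u z (n + 1) m =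
      (halfSumCut q z u n m - z * halfSumCut q u z n m) -
        (incrementCut q z u n m - z * incrementCut q u z n m) := by
  have a := halfSum_antisymm_succ hzu h1 hz hu n m
  have b := incrementCut_add_left hzu h1 hz hu n m
  have c := incrementCut_add_left ((mul_comm u z).trans hzu) h1 hu hz n m
  simp only [halfSumCut]
  linear_combination a + b - z * c

lemma halfSum_zero (q z u : F) (m : ℕ) : halfSum q z u 0 m = 1 := by
  induction m with
  | zero => simp [halfSum, weight, shiftedFactorial_zero]
  | succ m ih => simp [halfSum, weight, ih]

lemma halfSumCut_zero (q z u : F) (m : ℕ) : halfSumCut q z u 0 m = 1 := by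
  simp [halfSumCut, weight, halfSum_zero]

/-- The truncated sum over `[-m, m]` of level `n`, multiplied by `1 - z`. -/
lemma halfSum_antisymm (hzu : z * u = 1)
    (h1 : ∀ n, shiftedFactorial q 1 n ≠ 0) (hz : ∀ n, shiftedFactorial q (z ^ 2) n ≠ 0)
    (hu : ∀ n, shiftedFactorial q (u ^ 2) n ≠ 0) (n m : ℕ) :
    halfSum q z u n m - z * halfSum q u z n m =
      (1 - z) + ∑ i ∈ Finset.range n, (increment q z u i m - z * increment q u z i m) := by
  induction n with
  | zero => simp [halfSum_zero]
  | succ n ih =>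
    rw [halfSum_antisymm_succ hzu h1 hz hu, ih, Finset.sum_range_succ]
    ring

/-- The truncated sum over `[-m-1, m]` of level `n`, multiplied by `1 - z`. -/
lemma halfSumCut_antisymm (hzu : z * u = 1)
    (h1 : ∀ n, shiftedFactorial q 1 n ≠ 0) (hz : ∀ n, shiftedFactorial q (z ^ 2) n ≠ 0)
    (hu : ∀ n, shiftedFactorial q (u ^ 2) n ≠ 0) (n m : ℕ) :
    halfSumCut q z u n m - z * halfSumCut q u z n m =
      (1 - z) - ∑ i ∈ Finset.range n, (incrementCut q z u i m - z * incrementCut q u z i m) := by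
  induction n with
  | zero => simp [halfSumCut_zero]
  | succ n ih =>
    rw [halfSumCut_antisymm_succ hzu h1 hz hu, ih, Finset.sum_range_succ]
    ring

end Algebra

/-! ### Laurent series with non-negative coefficients -/

/-- All coefficients of the Laurent series `f` are non-negative. -/
def CoeffNonneg (f : LaurentSeries ℚ) : Prop := ∀ k, 0 ≤ f.coeff k

namespace CoeffNonneg

variable {f g : LaurentSeries ℚ}

lemma add (hf : CoeffNonneg f) (hg : CoeffNonneg g) : CoeffNonneg (f + g) := fun k => by
  rw [HahnSeries.coeff_add]; exact add_nonneg (hf k) (hg k)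

lemma mul (hf : CoeffNonneg f) (hg : CoeffNonneg g) : CoeffNonneg (f * g) := fun k => by
  rw [HahnSeries.coeff_mul]
  exact Finset.sum_nonneg fun i _ => mul_nonneg (hf _) (hg _)

lemma single (n : ℤ) : CoeffNonneg (HahnSeries.single n (1 : ℚ)) := fun k => by
  rw [HahnSeries.coeff_single]; split <;> norm_num

lemma qVar_zpow (n : ℤ) : CoeffNonneg (qVar ^ n) := by
  rw [_root_.qVar_zpow]; exact single n

lemma zero : CoeffNonneg 0 := fun k => by simp

lemma one : CoeffNonneg 1 := by simpa using qVar_zpow 0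

lemma sum {ι : Type*} {s : Finset ι} {f : ι → LaurentSeries ℚ} (h : ∀ i ∈ s, CoeffNonneg (f i)) :
    CoeffNonneg (∑ i ∈ s, f i) :=
  Finset.sum_induction _ _ (fun _ _ => add) zero h

lemma pow (hf : CoeffNonneg f) (n : ℕ) : CoeffNonneg (f ^ n) := by
  induction n with
  | zero => simpa using one
  | succ n ih => rw [pow_succ]; exact ih.mul hf

/-- Coefficients are locally constant, so that non-negativity passes to limits. -/
lemma of_tendsto {u : ℕ → LaurentSeries ℚ} (hu : Tendsto u atTop (𝓝 f))
    (h : ∀ n, CoeffNonneg (u n)) : CoeffNonneg f := fun k => by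
  let _ : UniformSpace ℚ := ⊥
  have hc := (LaurentSeries.uniformContinuous_coeff (K := ℚ) (uK := ⊥) k).continuous.tendsto f
  have hev : ∀ᶠ n in atTop, (u n).coeff k = f.coeff k := by
    have hopen : {f.coeff k} ∈ 𝓝 (f.coeff k) := by
      rw [nhds_discrete]; exact Set.mem_singleton _
    exact (hc.comp hu) hopen
  obtain ⟨n, hn⟩ := hev.exists
  rw [← hn]
  exact h n k

end CoeffNonneg

lemma qVar_ne_zero : qVar ≠ 0 := by simp [qVar]

lemma tendsto_qVar_zpow_pow {a : ℤ} (ha : 0 < a) :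
    Tendsto (fun n : ℕ => (qVar ^ a) ^ n) atTop (𝓝 0) := by
  refine Valued.tendsto_zero_pow_of_v_lt_one ?_
  rw [valuation_qVar_zpow, ← WithZero.exp_zero, WithZero.exp_lt_exp]
  omega

lemma one_sub_qVar_zpow_ne_zero {a : ℤ} (ha : a ≠ 0) : 1 - qVar ^ a ≠ 0 := by
  intro h
  have hv := congrArg (Valued.v (R := LaurentSeries ℚ)) (sub_eq_zero.mp h)
  rw [valuation_qVar_zpow, map_one, ← WithZero.exp_zero, WithZero.exp_inj] at hv
  omega

lemma CoeffNonneg.inv_one_sub {a : ℤ} (ha : 0 < a) : CoeffNonneg (1 - qVar ^ a)⁻¹ := by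
  have h0 := one_sub_qVar_zpow_ne_zero ha.ne'
  have ht : Tendsto (fun n : ℕ => (1 - (qVar ^ a) ^ n) * (1 - qVar ^ a)⁻¹) atTop
      (𝓝 ((1 - 0) * (1 - qVar ^ a)⁻¹)) :=
    (tendsto_const_nhds.sub (tendsto_qVar_zpow_pow ha)).mul_const _
  rw [sub_zero, one_mul] at ht
  refine .of_tendsto ht fun n => ?_
  rw [← mul_neg_geom_sum, mul_comm (1 - _), mul_assoc, mul_inv_cancel₀ h0, mul_one]
  exact .sum fun i _ => (CoeffNonneg.qVar_zpow a).pow i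

/-! ### Non-negativity of the increments -/

section Products

variable {R S : ℤ}

lemma shiftedFactorial_neg_nonneg (R e : ℤ) (n : ℕ) :
    CoeffNonneg (shiftedFactorial (qVar ^ R) (-qVar ^ e) n) := by
  induction n with
  | zero => rw [shiftedFactorial_zero]; exact .one
  | succ n ih =>
    rw [shiftedFactorial_succ, neg_mul, sub_neg_eq_add]
    exact ih.mul (.add .one ((CoeffNonneg.qVar_zpow e).mul ((CoeffNonneg.qVar_zpow R).pow _)))

lemma qVar_factor (R e : ℤ) (n : ℕ) :
    qVar ^ e * (qVar ^ R) ^ (n + 1) = qVar ^ (e + R * (n + 1)) := by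
  rw [zpow_add₀ qVar_ne_zero, zpow_mul]
  norm_cast

lemma exponent_pos {e : ℤ} (hR : 0 < R) (he : 0 < e + R) (n : ℕ) : 0 < e + R * (n + 1) := by
  nlinarith [mul_nonneg hR.le (Int.natCast_nonneg n)]

lemma shiftedFactorial_ne_zero {e : ℤ} (hR : 0 < R) (he : 0 < e + R) (n : ℕ) :
    shiftedFactorial (qVar ^ R) (qVar ^ e) n ≠ 0 := by
  rw [shiftedFactorial, Finset.prod_ne_zero_iff]
  intro i _
  rw [qVar_factor]
  exact one_sub_qVar_zpow_ne_zero (exponent_pos hR he i).ne'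

lemma shiftedFactorial_inv_nonneg {e : ℤ} (hR : 0 < R) (he : 0 < e + R) (n : ℕ) :
    CoeffNonneg (shiftedFactorial (qVar ^ R) (qVar ^ e) n)⁻¹ := by
  induction n with
  | zero => rw [shiftedFactorial_zero, inv_one]; exact .one
  | succ n ih =>
    rw [shiftedFactorial_succ, mul_inv, qVar_factor]
    exact ih.mul (.inv_one_sub (exponent_pos hR he n))

lemma shiftedFactorial_one_ne_zero (hR : 0 < R) (n : ℕ) :
    shiftedFactorial (qVar ^ R) 1 n ≠ 0 := by
  simpa using shiftedFactorial_ne_zero (e := 0) hR (by simpa using hR) n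

lemma qBinomial_pascal {F : Type*} [Field F] {q : F} (h0 : ∀ n, shiftedFactorial q 1 n ≠ 0)
    (a b : ℕ) :
    shiftedFactorial q 1 (a + b + 2) /
        (shiftedFactorial q 1 (a + 1) * shiftedFactorial q 1 (b + 1)) =
      shiftedFactorial q 1 (a + b + 1) / (shiftedFactorial q 1 a * shiftedFactorial q 1 (b + 1)) +
      q ^ (a + 1) * (shiftedFactorial q 1 (a + b + 1) /
        (shiftedFactorial q 1 (a + 1) * shiftedFactorial q 1 b)) := by
  have ha := factor_ne_zero h0 a
  have hb := factor_ne_zero h0 b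
  have h0a := h0 a
  have h0b := h0 b
  rw [shiftedFactorial_succ _ _ a, shiftedFactorial_succ _ _ b,
    shiftedFactorial_succ _ _ (a + b + 1)]
  generalize e1 : 1 - 1 * q ^ (a + 1) = D1 at *
  generalize e2 : 1 - 1 * q ^ (b + 1) = D2 at *
  field_simp
  rw [← e1, ← e2]
  ring

/-- Gaussian binomial coefficients have non-negative coefficients, by Pascal's rule. -/
lemma qBinomial_nonneg (hR : 0 < R) (a b : ℕ) :
    CoeffNonneg (shiftedFactorial (qVar ^ R) 1 (a + b) /
      (shiftedFactorial (qVar ^ R) 1 a * shiftedFactorial (qVar ^ R) 1 b)) := by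
  have h0 := shiftedFactorial_one_ne_zero hR
  induction h : a + b generalizing a b with
  | zero =>
    obtain ⟨rfl, rfl⟩ : a = 0 ∧ b = 0 := by omega
    simpa [shiftedFactorial_zero] using CoeffNonneg.one
  | succ c ih =>
    rcases a with _ | a
    · rw [← h, zero_add, shiftedFactorial_zero, one_mul, div_self (h0 b)]
      exact .one
    rcases b with _ | b
    · rw [← h, add_zero, shiftedFactorial_zero, mul_one, div_self (h0 _)]
      exact .one
    have h1 := ih a (b + 1) (by omega)
    have h2 := ih (a + 1) b (by omega)
    obtain rfl : c = a + b + 1 := by omega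
    rw [qBinomial_pascal h0]
    exact h1.add (((CoeffNonneg.qVar_zpow R).pow _).mul h2)

/-- If `c + 1 = a + b`, then `(q)_c / ((q)_a (q)_b)` becomes a Gaussian binomial coefficient or zero
when multiplied by `1 - q^(c+1)`, by `1 - q^a` or by `1 - q^b`. -/
lemma qBinomial_top_nonneg (hR : 0 < R) {a b c : ℕ} (h : c + 1 = a + b) :
    CoeffNonneg (shiftedFactorial (qVar ^ R) 1 c /
      (shiftedFactorial (qVar ^ R) 1 a * shiftedFactorial (qVar ^ R) 1 b) *
        (1 - (qVar ^ R) ^ (c + 1))) := by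
  have := qBinomial_nonneg hR a b
  rw [← h, shiftedFactorial_succ, one_mul] at this
  rwa [div_mul_eq_mul_div]

lemma qBinomial_left_nonneg (hR : 0 < R) {a b c : ℕ} (h : c + 1 = a + b) :
    CoeffNonneg (shiftedFactorial (qVar ^ R) 1 c /
      (shiftedFactorial (qVar ^ R) 1 a * shiftedFactorial (qVar ^ R) 1 b) *
        (1 - (qVar ^ R) ^ a)) := by
  rcases a with _ | a
  · simpa using CoeffNonneg.zero
  · obtain rfl : c = a + b := by omega
    have h0 := factor_ne_zero (shiftedFactorial_one_ne_zero hR) a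
    have := qBinomial_nonneg hR a b
    convert this using 1
    rw [one_mul] at h0
    have h1 := shiftedFactorial_one_ne_zero hR a
    have h2 := shiftedFactorial_one_ne_zero hR b
    rw [shiftedFactorial_succ, one_mul]
    field_simp

lemma qBinomial_right_nonneg (hR : 0 < R) {a b c : ℕ} (h : c + 1 = a + b) :
    CoeffNonneg (shiftedFactorial (qVar ^ R) 1 c /
      (shiftedFactorial (qVar ^ R) 1 a * shiftedFactorial (qVar ^ R) 1 b) *
        (1 - (qVar ^ R) ^ b)) := by
  rw [mul_comm (shiftedFactorial _ _ a)]
  exact qBinomial_left_nonneg hR (h.trans (add_comm a b))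

/-- For every `l ≥ 0`, the series `(u^l v - z^(l+1) w) / (1 - z)` has non-negative coefficients,
where `z = q^S` and `u = q^{-S}`. For `w` the image of `v` under `z ↔ u`, this says that the
antisymmetrisation of `u^l v` is non-negative. -/
def AntisymNonneg (S : ℤ) (v w : LaurentSeries ℚ) : Prop :=
  ∀ l : ℕ, CoeffNonneg (((qVar ^ (-S)) ^ l * v - qVar ^ S * ((qVar ^ S) ^ l * w)) / (1 - qVar ^ S))

lemma AntisymNonneg.of_symm {v : LaurentSeries ℚ} (hS : 0 < S) (hv : CoeffNonneg v) :
    AntisymNonneg S v v := fun l => by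
  have h0 := one_sub_qVar_zpow_ne_zero hS.ne'
  have : ((qVar ^ (-S)) ^ l * v - qVar ^ S * ((qVar ^ S) ^ l * v)) / (1 - qVar ^ S) =
      (qVar ^ (-S)) ^ l * (∑ i ∈ Finset.range (2 * l + 1), (qVar ^ S) ^ i) * v := by
    rw [div_eq_iff h0, mul_right_comm, mul_assoc _ _ (1 - qVar ^ S), geom_sum_mul_neg]
    have h1 : (qVar ^ (-S)) ^ l * (qVar ^ S) ^ l = 1 := by
      rw [← mul_pow, ← zpow_add₀ qVar_ne_zero]; simp
    linear_combination (qVar ^ S * (qVar ^ S) ^ l * v) * h1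
  rw [this]
  exact (((CoeffNonneg.qVar_zpow _).pow _).mul
    (.sum fun i _ => (CoeffNonneg.qVar_zpow S).pow i)).mul hv

/-- Dividing by `1 - u² a` amounts to replacing `l` by `l, l + 2, l + 4, …` with weights
`1, a, a², …`. The condition `2 * S < e` makes the geometric series in `u² a` converge. -/
lemma AntisymNonneg.div {v w : LaurentSeries ℚ} {e : ℤ} (hS : 0 < S) (he : 2 * S < e)
    (h : AntisymNonneg S v w) :
    AntisymNonneg S (v / (1 - (qVar ^ (-S)) ^ 2 * qVar ^ e))
      (w / (1 - (qVar ^ S) ^ 2 * qVar ^ e)) :=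
    fun l => by
  have e1 : (qVar ^ (-S)) ^ 2 * qVar ^ e = qVar ^ (e - 2 * S) := by
    rw [← zpow_natCast, ← zpow_mul, ← zpow_add₀ qVar_ne_zero]; congr 1; push_cast; ring
  have e2 : (qVar ^ S) ^ 2 * qVar ^ e = qVar ^ (e + 2 * S) := by
    rw [← zpow_natCast, ← zpow_mul, ← zpow_add₀ qVar_ne_zero]; congr 1; push_cast; ring
  have p1 : 0 < e - 2 * S := by omega
  have p2 : 0 < e + 2 * S := by omega
  have n1 := one_sub_qVar_zpow_ne_zero p1.ne'
  have n2 := one_sub_qVar_zpow_ne_zero p2.ne'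
  have t1 := tendsto_qVar_zpow_pow p1
  have t2 := tendsto_qVar_zpow_pow p2
  rw [← e1] at n1 t1
  rw [← e2] at n2 t2
  set z := qVar ^ S
  set u := qVar ^ (-S)
  set a := qVar ^ e with ha
  have ht : Tendsto (fun n : ℕ => (u ^ l * (v / (1 - u ^ 2 * a) * (1 - (u ^ 2 * a) ^ n)) -
      z * (z ^ l * (w / (1 - z ^ 2 * a) * (1 - (z ^ 2 * a) ^ n)))) / (1 - z)) atTop
      (𝓝 ((u ^ l * (v / (1 - u ^ 2 * a) * (1 - 0)) -
        z * (z ^ l * (w / (1 - z ^ 2 * a) * (1 - 0)))) / (1 - z))) := by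
    refine Tendsto.div_const (.sub ?_ ?_) _
    · exact ((tendsto_const_nhds.sub t1).const_mul _).const_mul _
    · exact (((tendsto_const_nhds.sub t2).const_mul _).const_mul _).const_mul _
  simp only [sub_zero, mul_one] at ht
  refine .of_tendsto ht fun n => ?_
  have : (u ^ l * (v / (1 - u ^ 2 * a) * (1 - (u ^ 2 * a) ^ n)) -
      z * (z ^ l * (w / (1 - z ^ 2 * a) * (1 - (z ^ 2 * a) ^ n)))) / (1 - z) =
      ∑ i ∈ Finset.range n,
        a ^ i * ((u ^ (l + 2 * i) * v - z * (z ^ (l + 2 * i) * w)) / (1 - z)) := by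
    have cancel : ∀ x s d : LaurentSeries ℚ, d ≠ 0 → x / d * (s * d) = x * s := by
      intro x s d hd
      field_simp
    rw [← geom_sum_mul_neg, ← geom_sum_mul_neg, cancel _ _ _ n1, cancel _ _ _ n2]
    simp only [Finset.mul_sum, ← Finset.sum_sub_distrib, Finset.sum_div]
    refine Finset.sum_congr rfl fun i _ => ?_
    ring
  rw [this]
  exact .sum fun i _ => ((CoeffNonneg.qVar_zpow e).pow i).mul (h (l + 2 * i))

lemma antisymNonneg_inv (hS : 0 < S) (hSR : 2 * S < R) {r s : ℕ} (hrs : r ≤ s) :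
    AntisymNonneg S
      (shiftedFactorial (qVar ^ R) ((qVar ^ S) ^ 2) r *
        shiftedFactorial (qVar ^ R) ((qVar ^ (-S)) ^ 2) s)⁻¹
      (shiftedFactorial (qVar ^ R) ((qVar ^ (-S)) ^ 2) r *
        shiftedFactorial (qVar ^ R) ((qVar ^ S) ^ 2) s)⁻¹ := by
  have hR : 0 < R := by omega
  induction s, hrs using Nat.le_induction with
  | base =>
    rw [mul_comm (shiftedFactorial _ ((qVar ^ (-S)) ^ 2) r)]
    refine .of_symm hS ?_
    rw [mul_inv, ← zpow_natCast, ← zpow_natCast, ← zpow_mul, ← zpow_mul]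
    exact (shiftedFactorial_inv_nonneg hR (by push_cast; omega) r).mul
      (shiftedFactorial_inv_nonneg hR (by push_cast; omega) r)
  | succ s _ ih =>
    have hpow : (qVar ^ R) ^ (s + 1) = qVar ^ (R * (s + 1)) := by
      rw [zpow_mul]; norm_cast
    have he : 2 * S < R * (s + 1) := by
      nlinarith [mul_nonneg hR.le (Int.natCast_nonneg s)]
    have := ih.div hS he
    rw [← hpow] at this
    rw [shiftedFactorial_succ _ _ s, shiftedFactorial_succ _ _ s, ← mul_assoc, ← mul_assoc,
      mul_inv, mul_inv _ (1 - _), ← div_eq_mul_inv, ← div_eq_mul_inv]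
    exact this

lemma increment_nonneg (hS : 0 < S) (hSR : 2 * S < R) (n m : ℕ) :
    CoeffNonneg ((increment (qVar ^ R) (qVar ^ S) (qVar ^ (-S)) n m -
      qVar ^ S * increment (qVar ^ R) (qVar ^ (-S)) (qVar ^ S) n m) / (1 - qVar ^ S)) := by
  have hR : 0 < R := by omega
  by_cases h : m ≤ n
  swap
  · simpa [increment, h] using CoeffNonneg.zero
  obtain ⟨k, rfl⟩ := Nat.exists_eq_add_of_le h
  simp only [increment, h, if_true, Nat.add_sub_cancel_left]
  have hc : 2 * m + 2 * k + 1 = (2 * m + k + 1) + k := by ring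
  have hq := CoeffNonneg.qVar_zpow R
  have t1 := qBinomial_left_nonneg hR hc
  have t2 := (hq.pow (m + k + 1)).mul (qBinomial_top_nonneg hR hc)
  have t3 := qBinomial_right_nonneg hR hc
  have ha := antisymNonneg_inv hS hSR (r := k) (s := 2 * m + k + 1) (by omega)
  have hX := shiftedFactorial_neg_nonneg R S (m + k)
  have hY := shiftedFactorial_neg_nonneg R (-S) (m + k)
  have total := ((hq.pow (secondPentagonal m + (2 * m + k + 1))).mul (hX.mul hY)).mul
    (((t1.mul (ha (3 * m + 2))).add (t2.mul (ha (3 * m + 1)))).add (t3.mul (ha (3 * m))))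
  convert total using 1
  simp only [boundary]
  generalize qVar ^ R = q
  generalize qVar ^ S = z
  generalize qVar ^ (-S) = u
  ring

lemma incrementCut_nonneg (hS : 0 < S) (hSR : 2 * S < R) (n m : ℕ) :
    CoeffNonneg ((incrementCut (qVar ^ R) (qVar ^ S) (qVar ^ (-S)) n m -
      qVar ^ S * incrementCut (qVar ^ R) (qVar ^ (-S)) (qVar ^ S) n m) / (1 - qVar ^ S)) := by
  have hR : 0 < R := by omega
  by_cases h : m ≤ n
  swap
  · simpa [incrementCut, h] using CoeffNonneg.zero
  obtain ⟨k, rfl⟩ := Nat.exists_eq_add_of_le h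
  simp only [incrementCut, h, if_true, Nat.add_sub_cancel_left]
  have hc : 2 * m + 2 * k + 1 + 1 = (2 * m + k + 2) + k := by ring
  have hq := CoeffNonneg.qVar_zpow R
  have t1 := qBinomial_left_nonneg hR hc
  have t2 := qBinomial_top_nonneg hR hc
  have t3 := qBinomial_right_nonneg hR hc
  -- With `p = q^k` and `v = q^(2m+k+2)`, so that `p v = q^(2m+2k+2)`, the coefficients are treated
  -- by `1 - p v² = (1 - p v) + p v (1 - v)` and `1 - p² v = (1 - p) + p (1 - p v)`.
  have c0 := (hq.pow k).mul (t2.add ((hq.pow (2 * m + 2 * k + 1 + 1)).mul t1))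
  have c1 := (hq.pow (m + k + 1)).mul (t3.add ((hq.pow k).mul t2))
  have ha := antisymNonneg_inv hS hSR (r := k) (s := 2 * m + k + 2) (by omega)
  have hX := shiftedFactorial_neg_nonneg R S (m + k)
  have hY := shiftedFactorial_neg_nonneg R (-S) (m + k)
  have total := ((hq.pow (secondPentagonal m + (3 * m + 2))).mul (hX.mul hY)).mul
    ((((c0.mul (ha (3 * m + 3))).add (c1.mul (ha (3 * m + 2)))).add
      (((hq.pow (m + k + 1)).mul t1).mul (ha (3 * m + 4)))).add
      (((hq.pow k).mul t3).mul (ha (3 * m + 1))))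
  convert total using 1
  simp only [boundaryCut]
  generalize qVar ^ R = q
  generalize qVar ^ S = z
  generalize qVar ^ (-S) = u
  ring

end Products

/-! ### The limit of the finite identities -/

section Limits

variable {R S : ℤ}

lemma valuation_qVar_zpow_lt_one (hR : 0 < R) : Valued.v (qVar ^ R) < 1 := by
  rw [valuation_qVar_zpow, ← WithZero.exp_zero, WithZero.exp_lt_exp]
  omega

lemma tendsto_qPochInf {y : LaurentSeries ℚ} (x : LaurentSeries ℚ) (hy : Valued.v y < 1) :
    Tendsto (fun n => ∏ i ∈ Finset.range n, (1 - x * y ^ i)) atTop (𝓝 (qPochInf x y)) :=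
  (multipliable_qPochInf hy).hasProd.tendsto_prod_nat

lemma tendsto_shiftedFactorial {q : LaurentSeries ℚ} (x : LaurentSeries ℚ) (hq : Valued.v q < 1) :
    Tendsto (fun n => shiftedFactorial q x n) atTop (𝓝 (qPochInf (x * q) q)) := by
  refine (tendsto_qPochInf (x * q) hq).congr fun n => ?_
  exact Finset.prod_congr rfl fun i _ => by ring

lemma qPochInf_eq_one_sub_mul {y : LaurentSeries ℚ} (x : LaurentSeries ℚ) (hy : Valued.v y < 1) :
    qPochInf x y = (1 - x) * qPochInf (x * y) y := by
  refine tendsto_nhds_unique ((tendsto_add_atTop_iff_nat 1).mpr (tendsto_qPochInf x hy)) ?_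
  refine ((tendsto_qPochInf (x * y) hy).const_mul (1 - x)).congr fun n => ?_
  rw [Finset.prod_range_succ', pow_zero, mul_one, mul_comm]
  exact congrArg (· * _) (Finset.prod_congr rfl fun i _ => by ring)

/-- The splitting `(x²q; q)_∞ = (xq; q)_∞ (-xq; q)_∞ (x²q; q²)_∞`, by which the factors
`(-zq)_∞ (-q/z)_∞` of the finite identity produce the quintuple product. -/
lemma qPochInf_sq {q : LaurentSeries ℚ} (x : LaurentSeries ℚ) (hq : Valued.v q < 1) :
    qPochInf (x ^ 2 * q) q =
      qPochInf (x * q) q * qPochInf (-x * q) q * qPochInf (x ^ 2 * q) (q ^ 2) := by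
  have hq2 : Valued.v (q ^ 2) < 1 := by
    rw [map_pow]; exact pow_lt_one₀ zero_le hq two_ne_zero
  refine tendsto_nhds_unique
    ((tendsto_qPochInf (x ^ 2 * q) hq).comp (tendsto_id.const_mul_atTop' two_pos)) ?_
  refine (((tendsto_qPochInf (x * q) hq).mul (tendsto_qPochInf (-x * q) hq)).mul
    (tendsto_qPochInf (x ^ 2 * q) hq2)).congr fun n => ?_
  simp only [Function.comp_apply, id]
  induction n with
  | zero => simp
  | succ n ih =>
    rw [show 2 * (n + 1) = 2 * n + 1 + 1 by ring, Finset.prod_range_succ _ (2 * n + 1),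
      Finset.prod_range_succ _ (2 * n),
      ← ih, Finset.prod_range_succ, Finset.prod_range_succ, Finset.prod_range_succ]
    ring

lemma qPochInf_qVar_ne_zero {e : ℤ} (hR : 0 < R) (he : 0 < e + R) :
    qPochInf (qVar ^ e * qVar ^ R) (qVar ^ R) ≠ 0 := by
  refine qPochInf_ne_zero (valuation_qVar_zpow_lt_one hR) fun i hi => ?_
  rw [mul_assoc, ← pow_succ', qVar_factor] at hi
  exact one_sub_qVar_zpow_ne_zero (exponent_pos hR he i).ne' (by rw [hi, sub_self])

/-- The limit of the weights as the level tends to infinity; it does not depend on the index `m`. -/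
noncomputable def weightLimit (R S : ℤ) : LaurentSeries ℚ :=
  qPochInf (1 * qVar ^ R) (qVar ^ R) *
      (qPochInf (-qVar ^ S * qVar ^ R) (qVar ^ R) * qPochInf (-qVar ^ (-S) * qVar ^ R) (qVar ^ R)) /
    (qPochInf (1 * qVar ^ R) (qVar ^ R) * qPochInf (1 * qVar ^ R) (qVar ^ R) *
      (qPochInf ((qVar ^ S) ^ 2 * qVar ^ R) (qVar ^ R) *
        qPochInf ((qVar ^ (-S)) ^ 2 * qVar ^ R) (qVar ^ R)))

lemma qVar_zpow_sq (e : ℤ) : (qVar ^ e) ^ 2 = qVar ^ (2 * e) := by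
  rw [← zpow_natCast, ← zpow_mul]; congr 1; push_cast; ring

lemma qPochInf_sq_ne_zero {e : ℤ} (hR : 0 < R) (he : 0 < 2 * e + R) :
    qPochInf ((qVar ^ e) ^ 2 * qVar ^ R) (qVar ^ R) ≠ 0 := by
  rw [qVar_zpow_sq]
  exact qPochInf_qVar_ne_zero hR he

lemma qPochInf_one_ne_zero (hR : 0 < R) : qPochInf (1 * qVar ^ R) (qVar ^ R) ≠ 0 := by
  simpa using qPochInf_qVar_ne_zero (e := 0) hR (by omega)

lemma tendsto_weight (hR : 0 < R) (hS₁ : -R < 2 * S) (hS₂ : 2 * S < R) (m : ℕ) :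
    Tendsto (fun n => weight (qVar ^ R) (qVar ^ S) (qVar ^ (-S)) n m) atTop
      (𝓝 (weightLimit R S)) := by
  have hv := valuation_qVar_zpow_lt_one hR
  have t := fun x => tendsto_shiftedFactorial x hv
  have hadd : Tendsto (fun n : ℕ => n + m) atTop atTop := tendsto_add_atTop_nat m
  have hsub : Tendsto (fun n : ℕ => n - m) atTop atTop := tendsto_sub_atTop_nat m
  have hdbl : Tendsto (fun n : ℕ => 2 * n) atTop atTop := tendsto_id.const_mul_atTop' two_pos
  have h0 := qPochInf_one_ne_zero hR
  have h1 := qPochInf_sq_ne_zero (e := S) hR (by omega)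
  have h2 := qPochInf_sq_ne_zero (e := -S) hR (by omega)
  have := (((t 1).comp hdbl).mul ((t (-qVar ^ S)).mul (t (-qVar ^ (-S))))).div
    ((((t 1).comp hadd).mul ((t 1).comp hsub)).mul
      (((t ((qVar ^ S) ^ 2)).comp hsub).mul ((t ((qVar ^ (-S)) ^ 2)).comp hadd)))
    (mul_ne_zero (mul_ne_zero h0 h0) (mul_ne_zero h1 h2))
  refine this.congr' ?_
  filter_upwards [eventually_ge_atTop m] with n hn
  simp [weight, hn]

lemma weightLimit_neg (R S : ℤ) : weightLimit R (-S) = weightLimit R S := by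
  rw [weightLimit, weightLimit, neg_neg, mul_comm (qPochInf (-qVar ^ (-S) * _) _),
    mul_comm (qPochInf ((qVar ^ (-S)) ^ 2 * _) _)]

lemma tendsto_weight_swap (hR : 0 < R) (hS₁ : -R < 2 * S) (hS₂ : 2 * S < R) (m : ℕ) :
    Tendsto (fun n => weight (qVar ^ R) (qVar ^ (-S)) (qVar ^ S) n m) atTop
      (𝓝 (weightLimit R S)) := by
  have := tendsto_weight (S := -S) hR (by omega) (by omega) m
  rwa [neg_neg, weightLimit_neg] at this

lemma weightLimit_nonneg (hS : 0 < S) (hSR : 2 * S < R) : CoeffNonneg (weightLimit R S) := by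
  have hR : 0 < R := by omega
  refine .of_tendsto (tendsto_weight hR (by omega) hSR 0) fun n => ?_
  have h1 := shiftedFactorial_inv_nonneg (e := 2 * S) hR (by omega) n
  have h2 := shiftedFactorial_inv_nonneg (e := 2 * -S) hR (by omega) n
  have h := ((qBinomial_nonneg hR n n).mul ((shiftedFactorial_neg_nonneg R S n).mul
    (shiftedFactorial_neg_nonneg R (-S) n))).mul (h1.mul h2)
  convert h using 1
  simp only [weight, Nat.zero_le, if_true, Nat.add_zero, Nat.sub_zero, qVar_zpow_sq, ← two_mul]
  ring

lemma weightLimit_mul_quintupleProduct (hS : 0 < S) (hSR : 2 * S < R) :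
    weightLimit R S * quintupleProduct R S = 1 - qVar ^ (-S) := by
  have hR : 0 < R := by omega
  have hv := valuation_qVar_zpow_lt_one hR
  have h0 := qPochInf_one_ne_zero hR
  have h1 := qPochInf_sq_ne_zero (e := S) hR (by omega)
  have h2 := qPochInf_sq_ne_zero (e := -S) hR (by omega)
  have e1 : qVar ^ (R + S) = qVar ^ S * qVar ^ R := by rw [← zpow_add₀ qVar_ne_zero, add_comm]
  have e2 : qVar ^ (R - 2 * S) = (qVar ^ (-S)) ^ 2 * qVar ^ R := by
    rw [qVar_zpow_sq, ← zpow_add₀ qVar_ne_zero]; congr 1; ring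
  have e3 : qVar ^ (R + 2 * S) = (qVar ^ S) ^ 2 * qVar ^ R := by
    rw [qVar_zpow_sq, ← zpow_add₀ qVar_ne_zero]; congr 1; ring
  have e4 : qPochInf (qVar ^ R) (qVar ^ R) = qPochInf (1 * qVar ^ R) (qVar ^ R) := by rw [one_mul]
  rw [quintupleProduct, e4, e1, e2, e3, ← qVar_zpow_sq R, qPochInf_eq_one_sub_mul (qVar ^ (-S)) hv,
    weightLimit, div_mul_eq_mul_div,
    div_eq_iff (mul_ne_zero (mul_ne_zero h0 h0) (mul_ne_zero h1 h2)),
    qPochInf_sq (qVar ^ S) hv, qPochInf_sq (qVar ^ (-S)) hv]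
  ring

/-- The `n`-th summand of the quintuple product series, divided by the quintuple product. -/
noncomputable def quintupleTerm (R S n : ℤ) : LaurentSeries ℚ :=
  qVar ^ (n * (3 * n + 1) * R / 2) * (qVar ^ (3 * n * S) - qVar ^ (-(3 * n + 1) * S)) /
    quintupleProduct R S

lemma qVar_inv_mul (S : ℤ) : qVar ^ S * qVar ^ (-S) = 1 := by
  rw [← zpow_add₀ qVar_ne_zero, add_neg_cancel, zpow_zero]

lemma quintupleTerm_natCast (hS : 0 < S) (hSR : 2 * S < R) (m : ℕ) :
    quintupleTerm R S m = (qVar ^ R) ^ secondPentagonal m *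
      (((qVar ^ (-S)) ^ (3 * m) - qVar ^ S * (qVar ^ S) ^ (3 * m)) * weightLimit R S /
        (1 - qVar ^ S)) := by
  have hQ := quintupleProduct_ne_zero R S (by omega) hSR
  have hW := weightLimit_mul_quintupleProduct hS hSR
  have h1 := one_sub_qVar_zpow_ne_zero hS.ne'
  have hu := qVar_inv_mul S
  have e1 : qVar ^ ((m : ℤ) * (3 * m + 1) * R / 2) = (qVar ^ R) ^ secondPentagonal m := by
    have : (m : ℤ) * (3 * m + 1) * R = 2 * (R * secondPentagonal m) := by
      have := two_mul_secondPentagonal m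
      zify at this
      linear_combination (-R) * this
    rw [this, Int.mul_ediv_cancel_left _ two_ne_zero, zpow_mul, zpow_natCast]
  have e2 : qVar ^ (3 * (m : ℤ) * S) = (qVar ^ S) ^ (3 * m) := by
    rw [← zpow_natCast, ← zpow_mul]; congr 1; push_cast; ring
  have e3 : qVar ^ (-(3 * (m : ℤ) + 1) * S) = (qVar ^ (-S)) ^ (3 * m + 1) := by
    rw [← zpow_natCast, ← zpow_mul]; congr 1; push_cast; ring
  rw [quintupleTerm, e1, e2, e3, div_eq_iff hQ, ← mul_div_assoc, div_mul_eq_mul_div, eq_div_iff h1]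
  generalize (qVar ^ R) ^ secondPentagonal m = G
  generalize qVar ^ S = z at *
  generalize qVar ^ (-S) = u at *
  linear_combination (-G * (u ^ (3 * m) - z * z ^ (3 * m))) * hW +
    (G * u ^ (3 * m) - G * z ^ (3 * m)) * hu

lemma quintupleTerm_neg (hS : 0 < S) (hSR : 2 * S < R) (m : ℕ) :
    quintupleTerm R S (-((m : ℤ) + 1)) = -((qVar ^ R) ^ (secondPentagonal m + (2 * m + 1)) *
      (((qVar ^ (-S)) ^ (3 * m + 2) - qVar ^ S * (qVar ^ S) ^ (3 * m + 2)) * weightLimit R S /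
        (1 - qVar ^ S))) := by
  have hQ := quintupleProduct_ne_zero R S (by omega) hSR
  have hW := weightLimit_mul_quintupleProduct hS hSR
  have h1 := one_sub_qVar_zpow_ne_zero hS.ne'
  have hu := qVar_inv_mul S
  have e1 : qVar ^ (-((m : ℤ) + 1) * (3 * -((m : ℤ) + 1) + 1) * R / 2) =
      (qVar ^ R) ^ (secondPentagonal m + (2 * m + 1)) := by
    have : -((m : ℤ) + 1) * (3 * -((m : ℤ) + 1) + 1) * R =
        2 * (R * (secondPentagonal m + (2 * m + 1) : ℕ)) := by
      have := two_mul_secondPentagonal m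
      zify at this
      push_cast
      linear_combination (-R) * this
    rw [this, Int.mul_ediv_cancel_left _ two_ne_zero, zpow_mul, zpow_natCast]
  have e2 : qVar ^ (3 * -((m : ℤ) + 1) * S) = (qVar ^ (-S)) ^ (3 * m + 3) := by
    rw [← zpow_natCast, ← zpow_mul]; congr 1; push_cast; ring
  have e3 : qVar ^ (-(3 * -((m : ℤ) + 1) + 1) * S) = (qVar ^ S) ^ (3 * m + 2) := by
    rw [← zpow_natCast, ← zpow_mul]; congr 1; push_cast; ring
  rw [quintupleTerm, e1, e2, e3, div_eq_iff hQ, ← mul_div_assoc, neg_mul, div_mul_eq_mul_div,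
    ← neg_div, eq_div_iff h1]
  generalize (qVar ^ R) ^ (secondPentagonal m + (2 * m + 1)) = G
  generalize qVar ^ S = z at *
  generalize qVar ^ (-S) = u at *
  linear_combination (G * (u ^ (3 * m + 2) - z * z ^ (3 * m + 2))) * hW +
    (G * z ^ (3 * m + 2) - G * u ^ (3 * m + 2)) * hu

/-! ### The extremal partial sums -/

lemma quintupleTerm_natCast_nonneg (hS : 0 < S) (hSR : 2 * S < R) (m : ℕ) :
    CoeffNonneg (quintupleTerm R S m) := by
  rw [quintupleTerm_natCast hS hSR]
  convert ((CoeffNonneg.qVar_zpow R).pow (secondPentagonal m)).mul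
    (AntisymNonneg.of_symm hS (weightLimit_nonneg hS hSR) (3 * m)) using 3
  ring

lemma neg_quintupleTerm_neg_nonneg (hS : 0 < S) (hSR : 2 * S < R) (m : ℕ) :
    CoeffNonneg (-quintupleTerm R S (-((m : ℤ) + 1))) := by
  rw [quintupleTerm_neg hS hSR, neg_neg]
  convert ((CoeffNonneg.qVar_zpow R).pow (secondPentagonal m + (2 * m + 1))).mul
    (AntisymNonneg.of_symm hS (weightLimit_nonneg hS hSR) (3 * m + 2)) using 3
  ring

lemma sum_Icc_add_one_right {M : Type*} [AddCommMonoid M] (f : ℤ → M) {a b : ℤ} (h : a ≤ b + 1) :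
    ∑ n ∈ Finset.Icc a (b + 1), f n = ∑ n ∈ Finset.Icc a b, f n + f (b + 1) := by
  rw [show Finset.Icc a (b + 1) = insert (b + 1) (Finset.Icc a b) by
    ext x; simp only [Finset.mem_insert, Finset.mem_Icc]; omega,
    Finset.sum_insert (by simp), add_comm]

lemma sum_Icc_sub_one_left {M : Type*} [AddCommMonoid M] (f : ℤ → M) {a b : ℤ} (h : a - 1 ≤ b) :
    ∑ n ∈ Finset.Icc (a - 1) b, f n = f (a - 1) + ∑ n ∈ Finset.Icc a b, f n := by
  rw [show Finset.Icc (a - 1) b = insert (a - 1) (Finset.Icc a b) by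
    ext x; simp only [Finset.mem_insert, Finset.mem_Icc]; omega,
    Finset.sum_insert (by simp)]

lemma tendsto_antisymm_weight (hS : 0 < S) (hSR : 2 * S < R) (p l m : ℕ) :
    Tendsto (fun n => ((qVar ^ R) ^ p * (qVar ^ (-S)) ^ l *
        weight (qVar ^ R) (qVar ^ S) (qVar ^ (-S)) n m -
      qVar ^ S * ((qVar ^ R) ^ p * (qVar ^ S) ^ l *
        weight (qVar ^ R) (qVar ^ (-S)) (qVar ^ S) n m)) / (1 - qVar ^ S)) atTop
      (𝓝 ((qVar ^ R) ^ p * (((qVar ^ (-S)) ^ l - qVar ^ S * (qVar ^ S) ^ l) * weightLimit R S /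
        (1 - qVar ^ S)))) := by
  have h := (((tendsto_weight (S := S) (R := R) (by omega) (by omega) hSR m).const_mul
    ((qVar ^ R) ^ p * (qVar ^ (-S)) ^ l)).sub
    (((tendsto_weight_swap (S := S) (R := R) (by omega) (by omega) hSR m).const_mul
      ((qVar ^ R) ^ p * (qVar ^ S) ^ l)).const_mul (qVar ^ S))).div_const (1 - qVar ^ S)
  convert h using 2
  ring

/-- The truncated finite sums tend to the partial sums over `[-m, m]` and `[-m-1, m]`. -/
lemma tendsto_halfSum (hS : 0 < S) (hSR : 2 * S < R) (m : ℕ) :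
    Tendsto (fun n => (halfSum (qVar ^ R) (qVar ^ S) (qVar ^ (-S)) n m -
      qVar ^ S * halfSum (qVar ^ R) (qVar ^ (-S)) (qVar ^ S) n m) / (1 - qVar ^ S)) atTop
      (𝓝 (∑ n ∈ Finset.Icc (-(m : ℤ)) m, quintupleTerm R S n)) ∧
    Tendsto (fun n => (halfSumCut (qVar ^ R) (qVar ^ S) (qVar ^ (-S)) n m -
      qVar ^ S * halfSumCut (qVar ^ R) (qVar ^ (-S)) (qVar ^ S) n m) / (1 - qVar ^ S)) atTop
      (𝓝 (∑ n ∈ Finset.Icc (-(m : ℤ) - 1) m, quintupleTerm R S n)) := by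
  have cut : ∀ m : ℕ, Tendsto (fun n => (halfSum (qVar ^ R) (qVar ^ S) (qVar ^ (-S)) n m -
      qVar ^ S * halfSum (qVar ^ R) (qVar ^ (-S)) (qVar ^ S) n m) / (1 - qVar ^ S)) atTop
      (𝓝 (∑ n ∈ Finset.Icc (-(m : ℤ)) m, quintupleTerm R S n)) →
    Tendsto (fun n => (halfSumCut (qVar ^ R) (qVar ^ S) (qVar ^ (-S)) n m -
      qVar ^ S * halfSumCut (qVar ^ R) (qVar ^ (-S)) (qVar ^ S) n m) / (1 - qVar ^ S)) atTop
      (𝓝 (∑ n ∈ Finset.Icc (-(m : ℤ) - 1) m, quintupleTerm R S n)) := by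
    intro m h
    rw [sum_Icc_sub_one_left _ (by omega), show -(m : ℤ) - 1 = -((m : ℤ) + 1) by ring,
      quintupleTerm_neg hS hSR, neg_add_eq_sub]
    refine (h.sub (tendsto_antisymm_weight hS hSR (secondPentagonal m + (2 * m + 1)) (3 * m + 2)
      (m + 1))).congr fun n => ?_
    simp only [halfSumCut]
    ring
  suffices h : Tendsto (fun n => (halfSum (qVar ^ R) (qVar ^ S) (qVar ^ (-S)) n m -
      qVar ^ S * halfSum (qVar ^ R) (qVar ^ (-S)) (qVar ^ S) n m) / (1 - qVar ^ S)) atTop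
      (𝓝 (∑ n ∈ Finset.Icc (-(m : ℤ)) m, quintupleTerm R S n)) from ⟨h, cut m h⟩
  induction m with
  | zero =>
    have h := tendsto_antisymm_weight hS hSR (secondPentagonal 0) (3 * 0) 0
    rw [← quintupleTerm_natCast hS hSR] at h
    simpa [halfSum, secondPentagonal] using h
  | succ m ih =>
    rw [Nat.cast_succ, sum_Icc_add_one_right _ (by omega), neg_add, ← sub_eq_add_neg,
      ← Nat.cast_succ, quintupleTerm_natCast hS hSR]
    refine ((cut m ih).add (tendsto_antisymm_weight hS hSR (secondPentagonal (m + 1))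
      (3 * (m + 1)) (m + 1))).congr fun n => ?_
    simp only [halfSumCut, halfSum]
    ring

lemma shiftedFactorial_nonvanishing (hS : 0 < S) (hSR : 2 * S < R) :
    (∀ n, shiftedFactorial (qVar ^ R) 1 n ≠ 0) ∧
    (∀ n, shiftedFactorial (qVar ^ R) ((qVar ^ S) ^ 2) n ≠ 0) ∧
    ∀ n, shiftedFactorial (qVar ^ R) ((qVar ^ (-S)) ^ 2) n ≠ 0 := by
  have hR : 0 < R := by omega
  rw [qVar_zpow_sq, qVar_zpow_sq]
  exact ⟨shiftedFactorial_one_ne_zero hR, shiftedFactorial_ne_zero hR (by omega),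
    shiftedFactorial_ne_zero hR (by omega)⟩

lemma symmetric_sum_sub_one_nonneg (hS : 0 < S) (hSR : 2 * S < R) (m : ℕ) :
    CoeffNonneg (∑ n ∈ Finset.Icc (-(m : ℤ)) m, quintupleTerm R S n - 1) := by
  obtain ⟨h1, hz, hu⟩ := shiftedFactorial_nonvanishing hS hSR
  have h0 := one_sub_qVar_zpow_ne_zero hS.ne'
  refine .of_tendsto ((tendsto_halfSum hS hSR m).1.sub_const 1) fun n => ?_
  rw [halfSum_antisymm (qVar_inv_mul S) h1 hz hu, add_div, div_self h0, add_sub_cancel_left,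
    Finset.sum_div]
  exact .sum fun i _ => increment_nonneg hS hSR i m

lemma one_sub_cut_sum_nonneg (hS : 0 < S) (hSR : 2 * S < R) (m : ℕ) :
    CoeffNonneg (1 - ∑ n ∈ Finset.Icc (-(m : ℤ) - 1) m, quintupleTerm R S n) := by
  obtain ⟨h1, hz, hu⟩ := shiftedFactorial_nonvanishing hS hSR
  have h0 := one_sub_qVar_zpow_ne_zero hS.ne'
  refine .of_tendsto ((tendsto_halfSum hS hSR m).2.const_sub 1) fun n => ?_
  rw [halfSumCut_antisymm (qVar_inv_mul S) h1 hz hu, sub_div, div_self h0, sub_sub_cancel,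
    Finset.sum_div]
  exact .sum fun i _ => incrementCut_nonneg hS hSR i m

lemma quintupleTerm_nonneg (hS : 0 < S) (hSR : 2 * S < R) {n : ℤ} (hn : 0 ≤ n) :
    CoeffNonneg (quintupleTerm R S n) := by
  lift n to ℕ using hn
  exact quintupleTerm_natCast_nonneg hS hSR n

lemma neg_quintupleTerm_nonneg (hS : 0 < S) (hSR : 2 * S < R) {n : ℤ} (hn : n < 0) :
    CoeffNonneg (-quintupleTerm R S n) := by
  obtain ⟨m, rfl⟩ : ∃ m : ℕ, n = -((m : ℤ) + 1) := ⟨(-n - 1).toNat, by omega⟩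
  exact neg_quintupleTerm_neg_nonneg hS hSR m

lemma sum_Icc_split {M : Type*} [AddCommMonoid M] (f : ℤ → M) {a b c : ℤ} (hab : a ≤ b + 1)
    (hbc : b ≤ c) :
    ∑ n ∈ Finset.Icc a c, f n = ∑ n ∈ Finset.Icc a b, f n + ∑ n ∈ Finset.Icc (b + 1) c, f n := by
  rw [← Finset.sum_union]
  · congr 1
    ext x; simp only [Finset.mem_union, Finset.mem_Icc]; omega
  · rw [Finset.disjoint_left]
    intro x; simp only [Finset.mem_Icc]; omega

lemma coeff_nonneg_of_sub_one {f : LaurentSeries ℚ} (h : CoeffNonneg (f - 1)) {k : ℤ}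
    (hk : 1 ≤ k) : 0 ≤ f.coeff k := by
  have := h k
  rwa [HahnSeries.coeff_sub, HahnSeries.coeff_one, if_neg (by omega), sub_zero] at this

lemma coeff_nonneg_of_one_sub {f : LaurentSeries ℚ} (h : CoeffNonneg (1 - f)) {k : ℤ}
    (hk : 1 ≤ k) : 0 ≤ (-f).coeff k := by
  have := h k
  rwa [HahnSeries.coeff_sub, HahnSeries.coeff_one, if_neg (by omega), zero_sub,
    ← HahnSeries.coeff_neg] at this

end Limits

theorem theorem1p3 (a b R S : ℤ) (hS : 1 ≤ S) (hSR : 2 * S < R) (k : ℤ) (hk : 1 ≤ k) :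
    0 ≤ (((Sg (a + b) : LaurentSeries ℚ) / quintupleProduct R S) *
      quintuplePartialSum R S a b).coeff k := by
  have hS' : 0 < S := hS
  have hsum : (Sg (a + b) : LaurentSeries ℚ) / quintupleProduct R S * quintuplePartialSum R S a b =
      (Sg (a + b) : LaurentSeries ℚ) * ∑ n ∈ Finset.Icc a b, quintupleTerm R S n := by
    simp only [quintupleTerm, quintuplePartialSum, ← Finset.sum_div]
    ring
  rw [hsum]
  rcases le_or_gt 0 (a + b) with h | h
  · rw [Sg, if_pos h, Int.cast_one, one_mul]
    rcases le_or_gt 0 a with ha | ha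
    · refine CoeffNonneg.sum (fun n hn => ?_) k
      exact quintupleTerm_nonneg hS' hSR (ha.trans (Finset.mem_Icc.mp hn).1)
    · -- `b ≥ m = -a`: the sum is the one over `[-m, m]` plus non-negative terms.
      obtain ⟨m, rfl⟩ : ∃ m : ℕ, a = -(m : ℤ) := ⟨(-a).toNat, by omega⟩
      refine coeff_nonneg_of_sub_one ?_ hk
      rw [sum_Icc_split _ (b := (m : ℤ)) (by omega) (by omega), add_sub_right_comm]
      refine (symmetric_sum_sub_one_nonneg hS' hSR m).add (.sum fun n hn => ?_)
      exact quintupleTerm_nonneg hS' hSR (by have := (Finset.mem_Icc.mp hn).1; omega)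
  · rw [Sg, if_neg (by omega), Int.cast_neg, Int.cast_one, neg_one_mul]
    rcases lt_or_ge b 0 with hb | hb
    · rw [← Finset.sum_neg_distrib]
      refine CoeffNonneg.sum (fun n hn => ?_) k
      exact neg_quintupleTerm_nonneg hS' hSR ((Finset.mem_Icc.mp hn).2.trans_lt hb)
    · -- `a = -m-1` and `b ≤ m`: the sum is the one over `[-m-1, m]` minus non-negative terms.
      obtain ⟨m, rfl⟩ : ∃ m : ℕ, a = -(m : ℤ) - 1 := ⟨(-a - 1).toNat, by omega⟩
      refine coeff_nonneg_of_one_sub ?_ hk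
      have hm := one_sub_cut_sum_nonneg hS' hSR m
      rw [sum_Icc_split _ (b := b) (by omega) (by omega)] at hm
      have htail : CoeffNonneg (∑ n ∈ Finset.Icc (b + 1) (m : ℤ), quintupleTerm R S n) :=
        .sum fun n hn => quintupleTerm_nonneg hS' hSR (by have := (Finset.mem_Icc.mp hn).1; omega)
      have := hm.add htail
      rwa [← sub_sub, sub_add_cancel] at this
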